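/- A temporal graph $\mathcal{G}=(V,E,\lambda)$ consists of a finite simple graph $(V,E)$ and a map $\lambda$ assigning to every edge a finite set of positive real time labels. A time-respecting path arriving by time $t$ is a (possibly trivial) path of $(V,E)$ together with a choice of one label for each of its edges such that the chosen labels are strictly increasing along the path and are all at most $t$. For $S\subseteq V$ and $t\in\mathbb{N}_0$, let $B_{\mathcal{G}}(S,t)$ be the set of vertices reachable from some vertex of $S$ by a time-respecting path arriving by time $t$. Let $\mathrm{Double}_{\mathcal{G}}(S)=\min\{t\in\mathbb{N}_0 : |B_{\mathcal{G}}(S,t)|\ge 2|S|\}$, with value $\infty$ if no such $t$ exists. The doubling time of $\mathcal{G}$ is $$\mathbf{Double}(\mathcal{G})=\max_{S\subseteq V,\ |S|\le |V|/2}\mathrm{Double}_{\mathcal{G}}(S)\in\mathbb{N}_0\cup\{\infty\}.$$ The Random Simple Temporal Graph (RSTG) on $[n]$ with parameter $p\in[0,1]$ is obtained by drawing an Erdős–Rényi graph $G(n,p)$ and then ordering its edges uniformly at random, the single label of each edge being its position $1,2,\dots,|E|$ in this order. **Corollary (RSTG doubling time).** Let $\beta:\mathbb{N}\to[0,1]$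 and, for each $n$, let $\mathcal{H}_n$ be a sample from the RSTG distribution on $[n]$ with parameter $\beta(n)$. 1. If there is a constant $c>0$ such that $\beta(n)>(2+c)\frac{\log n}{n}$ for all sufficiently large $n$, then $\mathbb{P}[\mathbf{Double}(\mathcal{H}_n)<\infty]\to 1$ as $n\to\infty$. 2. If there is a constant $c>0$ such that $\beta(n)<(2-c)\frac{\log n}{n}$ for all sufficiently large $n$, then $\mathbb{P}[\mathbf{Double}(\mathcal{H}_n)=\infty]\to 1$ as $n\to\infty$. -/

import Mathlib

open Filter Topology MeasureTheory

/-- A temporal graph on the vertex set `V`: a static graph together with a labelling that assigns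
to every edge a finite set of positive real time labels. -/
structure TemporalGraph (V : Type*) where
  /-- The underlying static graph. -/
  graph : SimpleGraph V
  /-- The finite set of time labels of an edge. -/
  label : graph.edgeSet → Finset ℝ
  label_pos : ∀ e, ∀ s ∈ label e, 0 < s

namespace TemporalGraph

variable {V : Type*}

/-- `H.Reaches u v t`: there is a time-respecting path from `u` to `v` arriving by time `t`, i.e.
a path of the underlying graph, and a choice of one label `ℓ i` for each of its edges, such that
the chosen labels strictly increase along the path and none of them exceeds `t`. The trivial path
from `u` to `u` arrives by every time. -/
def Reaches (H : TemporalGraph V) (u v : V) (t : ℝ) : Prop :=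
  ∃ (p : H.graph.Walk u v) (ℓ : List ℝ), p.IsPath ∧
    List.Forall₂ (fun e s => ∃ he : e ∈ H.graph.edgeSet, s ∈ H.label ⟨e, he⟩) p.edges ℓ ∧
    ℓ.Pairwise (· < ·) ∧ ∀ s ∈ ℓ, s ≤ t

/-- The `t`-step reachability ball of a set `S` of vertices. -/
def ball (H : TemporalGraph V) (S : Finset V) (t : ℕ) : Set V :=
  {v | ∃ u ∈ S, H.Reaches u v t}

/-- The doubling time of a set `S` of vertices: the least `t : ℕ` at which the reachability ball
has at least `2 |S|` elements, and `⊤` if there is no such `t`. -/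
noncomputable def doubleOf (H : TemporalGraph V) (S : Finset V) : ℕ∞ :=
  ⨅ (t : ℕ) (_ : 2 * S.card ≤ (H.ball S t).ncard), (t : ℕ∞)

/-- The doubling time of a temporal graph: the maximum of the doubling times of the sets of at most
half of the vertices. -/
noncomputable def double (H : TemporalGraph V) : ℕ∞ :=
  ⨆ (S : Finset V) (_ : 2 * S.card ≤ Nat.card V), H.doubleOf S

/-- A linear order on the edges of `G`, given as a bijection of the edges onto their ranks. -/
abbrev EdgeOrder (G : SimpleGraph V) : Type _ :=
  G.edgeSet ≃ Fin (Nat.card G.edgeSet)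

/-- The simple temporal graph in which each edge of `G` has exactly one label, its position
`1, 2, …, |E(G)|` in the order `σ`. -/
noncomputable def ofEdgeOrder (G : SimpleGraph V) (σ : EdgeOrder G) : TemporalGraph V where
  graph := G
  label e := {((σ e : ℕ) : ℝ) + 1}
  label_pos e s hs := by
    rw [Finset.mem_singleton] at hs
    subst hs
    positivity

instance [Finite V] (G : SimpleGraph V) : Nonempty (EdgeOrder G) :=
  ⟨Finite.equivFin _⟩

/-- The uniform distribution on the linear orders of the edges of `G`. -/
noncomputable def uniformEdgeOrder [Finite V] (G : SimpleGraph V) : PMF (EdgeOrder G) :=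
  letI : Fintype (EdgeOrder G) := Fintype.ofFinite _
  PMF.uniformOfFintype (EdgeOrder G)

/-- Every set of temporal graphs is an event. -/
instance : MeasurableSpace (TemporalGraph V) := ⊤

instance [Finite V] : MeasurableSingletonClass (SimpleGraph V) where
  measurableSet_singleton G := by
    rw [← SimpleGraph.measurableEmbedding_edgeSet.measurableSet_image, Set.image_singleton]
    exact MeasurableSet.singleton _

/-- The Random Simple Temporal Graph distribution on the vertex set `V` with parameter `p`: draw an
Erdős–Rényi graph, in which each pair of vertices is an edge independently with probability `p`,
and then order its edges uniformly at random. -/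
noncomputable def rstg (V : Type*) [Finite V] (p : unitInterval) : PMF (TemporalGraph V) :=
  (SimpleGraph.binomialRandom V p).toPMF.bind fun G =>
    (uniformEdgeOrder G).map (ofEdgeOrder G)

end TemporalGraph

/-! Replace the random order of the edges by independent time slots: every pair of vertices draws
one of `N + 1` values, the first `N` being equally likely slots and the last one meaning that the
edge is absent. Breaking the ties inside the slots uniformly at random gives back the uniform
order, so an event of the random temporal graph is at least as likely as the set of slot
configurations all of whose refinements lie in it.

For `p > (2 + c) log n / n`, if a set of `k` vertices never doubles, then some set `U` of
`n - 2k + 1` vertices is never reached from it, so exploring backwards in time from `U` one finds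
at most `n - k` vertices. A product-form potential of the number of explored vertices, whose
expectation shrinks by the factor `1 - (1 - ε) q x (n - x)` in each slot of probability `q`,
bounds the probability of this, and the bound beats the union over `U`: each of the `min(|U|, k)`
vertices contributes `n^{-(2 + c/2)}` against about `n²` choices.

For `p < (2 - c) log n / n`, a vertex without edges in the second half of the time can only be
reached by chains of edges from the first half. A vertex has this property with probability about
`(1 - p / 2)^n ≈ n^{-1 + c/2}`, so by the second moment method there are many such vertices.
Counting early chains shows that most of them are reached from at most a quarter of all vertices.
Two such vertices leave half of the vertices reaching neither of them, and this half never
doubles. -/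

namespace TemporalGraph

section Refines

variable {E κ : Type*} [LinearOrder κ] {M : ℕ}

/-- The order `σ` of `E` refines the labelling `X`: a smaller label means an earlier position. It
couples a labelling, possibly with ties, with a strict order. -/
def Refines (X : E → κ) (σ : E ≃ Fin M) : Prop :=
  ∀ ⦃e e' : E⦄, X e < X e' → σ e < σ e'

theorem refines_trans_sort_symm (X : E → κ) (τ : E ≃ Fin M) :
    Refines X (τ.trans (Tuple.sort (X ∘ τ.symm)).symm) := by
  intro e e' h
  by_contra! hle
  have := Tuple.monotone_sort (X ∘ τ.symm) hle
  simp only [Function.comp_apply, Equiv.trans_apply, Equiv.apply_symm_apply,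
    Equiv.symm_apply_apply] at this
  exact this.not_gt h

/-- Double counting: `(X, τ)` is recovered from `X ∘ τ⁻¹` and the order obtained from `τ` by sorting
`X`. -/
theorem ncard_mul_card_le_of_refines [Finite E] [Finite κ] {B : Set (E → κ)}
    {A : Set (E ≃ Fin M)} (h : ∀ X ∈ B, ∀ σ, Refines X σ → σ ∈ A) :
    B.ncard * Nat.card (E ≃ Fin M) ≤ Nat.card κ ^ M * A.ncard := by
  have hcard : Nat.card κ ^ M * A.ncard = ((Set.univ : Set (Fin M → κ)) ×ˢ A).ncard := by
    rw [Set.ncard_prod, Set.ncard_univ, Nat.card_fun, Nat.card_fin]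
  rw [hcard, ← Set.ncard_univ, ← Set.ncard_prod]
  refine Set.ncard_le_ncard_of_injOn
    (fun Xτ => (Xτ.1 ∘ Xτ.2.symm, Xτ.2.trans (Tuple.sort (Xτ.1 ∘ Xτ.2.symm)).symm)) ?_ ?_
  · rintro ⟨X, τ⟩ ⟨hX, -⟩
    exact ⟨Set.mem_univ _, h X hX _ (refines_trans_sort_symm X τ)⟩
  · rintro ⟨X, τ⟩ - ⟨X', τ'⟩ - heq
    obtain ⟨hZ, hσ⟩ := Prod.mk.inj heq
    have hτ : τ = τ' := by
      dsimp only at hZ hσ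
      rw [← hZ] at hσ
      exact Equiv.ext fun e =>
        (Tuple.sort (X ∘ τ.symm)).symm.injective (DFunLike.congr_fun hσ e)
    subst hτ
    exact Prod.ext (τ.symm.surjective.injective_comp_right hZ) rfl

end Refines

section ProductMeasure

variable {ι : Type*} [Fintype ι] {α : ι → Type*} [∀ i, MeasurableSpace (α i)]

theorem measureReal_pi_pi (μ : ∀ i, Measure (α i)) [∀ i, SigmaFinite (μ i)]
    (s : ∀ i, Set (α i)) : (Measure.pi μ).real (Set.univ.pi s) = ∏ i, (μ i).real (s i) := by
  simp only [measureReal_def, Measure.pi_pi, ENNReal.toReal_prod]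

end ProductMeasure

section Slots

variable {V : Type*} {N : ℕ}

/-- The graph of the pairs that are assigned one of the first `N` slots. The last value of
`Fin (N + 1)` stands for the absence of the pair, and the slots of diagonal pairs are ignored. -/
def slotGraph (Y : Sym2 V → Fin (N + 1)) : SimpleGraph V :=
  SimpleGraph.fromEdgeSet {e | (Y e : ℕ) < N}

theorem mem_edgeSet_slotGraph {Y : Sym2 V → Fin (N + 1)} {e : Sym2 V} :
    e ∈ (slotGraph Y).edgeSet ↔ (Y e : ℕ) < N ∧ ¬ e.IsDiag := by
  simp [slotGraph]

/-- The law of a single slot: each of the `N` slots has mass `p / N` and the absent slot has mass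
`1 - p`. -/
noncomputable def slotMeasure (N : ℕ) (p : unitInterval) : Measure (Fin (N + 1)) :=
  ∑ s : Fin N, ENNReal.ofReal (p / N) • Measure.dirac s.castSucc +
    ENNReal.ofReal (1 - p) • Measure.dirac (Fin.last N)

instance (p : unitInterval) : IsFiniteMeasure (slotMeasure N p) where
  measure_univ_lt_top := by simp [slotMeasure, ENNReal.mul_lt_top_iff]

open scoped Classical in
theorem slotMeasure_real_apply (p : unitInterval) (S : Set (Fin (N + 1))) :
    (slotMeasure N p).real S =
      (Finset.univ.filter fun s : Fin N => s.castSucc ∈ S).card * (p / N) +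
        if Fin.last N ∈ S then 1 - (p : ℝ) else 0 := by
  have h0 : 0 ≤ (p : ℝ) / N := div_nonneg p.2.1 N.cast_nonneg
  have hp : 0 ≤ 1 - (p : ℝ) := sub_nonneg.2 p.2.2
  simp only [slotMeasure, measureReal_def, Measure.add_apply, Measure.finsetSum_apply,
    Measure.smul_apply, Measure.dirac_apply, smul_eq_mul, Set.indicator_apply, Pi.one_apply,
    mul_ite, mul_one, mul_zero, ← Finset.sum_filter, Finset.sum_const, nsmul_eq_mul]
  rw [ENNReal.toReal_add (by finiteness) (by finiteness), ENNReal.toReal_mul,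
    ENNReal.toReal_natCast, ENNReal.toReal_ofReal h0, apply_ite ENNReal.toReal,
    ENNReal.toReal_ofReal hp, ENNReal.toReal_zero]

theorem slotMeasure_real_castSucc (p : unitInterval) (s : Fin N) :
    (slotMeasure N p).real {s.castSucc} = p / N := by
  simp [slotMeasure_real_apply, (Fin.castSucc_ne_last s).symm, Finset.filter_eq']

theorem slotMeasure_real_last (p : unitInterval) :
    (slotMeasure N p).real {Fin.last N} = 1 - p := by
  simp [slotMeasure_real_apply]

instance [NeZero N] (p : unitInterval) : IsProbabilityMeasure (slotMeasure N p) where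
  measure_univ := by
    rw [← ENNReal.toReal_eq_one_iff, ← measureReal_def, slotMeasure_real_apply]
    simp [mul_div_cancel₀, NeZero.ne N]

/-- Independent slots for all pairs of vertices. -/
noncomputable def slotLaw (V : Type*) [Fintype V] [DecidableEq V] (N : ℕ) (p : unitInterval) :
    Measure (Sym2 V → Fin (N + 1)) :=
  Measure.pi fun _ => slotMeasure N p

variable [Fintype V] [DecidableEq V]

instance [NeZero N] (p : unitInterval) : IsProbabilityMeasure (slotLaw V N p) :=
  inferInstanceAs (IsProbabilityMeasure (Measure.pi _))

open scoped Classical in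
theorem prod_edge_ite (G : SimpleGraph V) (a b : ℝ) :
    ∏ e : Sym2 V, (if e.IsDiag then 1 else if e ∈ G.edgeSet then a else b) =
      a ^ G.edgeSet.ncard * b ^ ((Nat.card V).choose 2 - G.edgeSet.ncard) := by
  have hd : (Finset.univ.filter fun e : Sym2 V => ¬ e.IsDiag).card = (Nat.card V).choose 2 := by
    rw [Nat.card_eq_fintype_card, ← Sym2.card_diagSet_compl, ← Fintype.card_subtype]
    exact Fintype.card_congr (Equiv.subtypeEquivRight fun e => by simp)
  have hE : ((Finset.univ.filter fun e : Sym2 V => ¬ e.IsDiag).filter (· ∈ G.edgeSet)).card =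
      G.edgeSet.ncard := by
    rw [← Set.ncard_coe_finset]
    congr 1
    ext e
    simpa using fun h => G.not_isDiag_of_mem_edgeSet h
  have hsplit := Finset.card_filter_add_card_filter_not
    (s := Finset.univ.filter fun e : Sym2 V => ¬ e.IsDiag) (p := (· ∈ G.edgeSet))
  rw [Finset.prod_ite, Finset.prod_const_one, one_mul, Finset.prod_ite, Finset.prod_const,
    Finset.prod_const, hE, ← hd, ← hsplit, hE, Nat.add_sub_cancel_left]

/-- Fixing the graph and the slots of its edges determines `Y` off the diagonal. -/
theorem slotLaw_real_slotGraph_eq_and_slots_eq [NeZero N] (p : unitInterval) (G : SimpleGraph V)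
    (X : G.edgeSet → Fin N) :
    (slotLaw V N p).real {Y | slotGraph Y = G ∧ ∀ e : G.edgeSet, Y e = (X e).castSucc} =
      ((p : ℝ) / N) ^ G.edgeSet.ncard *
        (1 - p) ^ ((Nat.card V).choose 2 - G.edgeSet.ncard) := by
  classical
  let box : Sym2 V → Set (Fin (N + 1)) := fun e =>
    if e.IsDiag then Set.univ
    else if h : e ∈ G.edgeSet then {(X ⟨e, h⟩).castSucc} else {Fin.last N}
  have hbox : {Y : Sym2 V → Fin (N + 1) |
      slotGraph Y = G ∧ ∀ e : G.edgeSet, Y e = (X e).castSucc} = Set.univ.pi box := by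
    ext Y
    simp only [Set.mem_ofPred_eq, Set.mem_univ_pi, box]
    constructor
    · rintro ⟨rfl, hX⟩ e
      split_ifs with hdiag he
      · exact Set.mem_univ _
      · exact hX ⟨e, he⟩
      · have hlt : ¬ (Y e : ℕ) < N := fun hlt => he (mem_edgeSet_slotGraph.2 ⟨hlt, hdiag⟩)
        exact Fin.ext (le_antisymm (Y e).is_le (not_lt.1 hlt))
    · intro hY
      have hX : ∀ e : G.edgeSet, Y e = (X e).castSucc := fun e => by
        simpa [G.not_isDiag_of_mem_edgeSet e.2] using hY e
      refine ⟨SimpleGraph.edgeSet_inj.1 (Set.ext fun e => ?_), hX⟩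
      rw [mem_edgeSet_slotGraph]
      refine ⟨fun ⟨hlt, hdiag⟩ => ?_, fun he => ?_⟩
      · by_contra he
        have : Y e = Fin.last N := by simpa [hdiag, he] using hY e
        simp [this] at hlt
      · exact ⟨by simp [hX ⟨e, he⟩], G.not_isDiag_of_mem_edgeSet he⟩
  rw [hbox, slotLaw, measureReal_pi_pi, ← prod_edge_ite]
  refine Finset.prod_congr rfl fun e _ => ?_
  simp only [box]
  split_ifs
  · exact probReal_univ
  · exact slotMeasure_real_castSucc p _
  · exact slotMeasure_real_last p

theorem rstg_toMeasure_eq_sum (p : unitInterval) (A : Set (TemporalGraph V)) :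
    (rstg V p).toMeasure A = ∑ G : SimpleGraph V, SimpleGraph.binomialRandom V p {G} *
      (uniformEdgeOrder G).toOuterMeasure (ofEdgeOrder G ⁻¹' A) := by
  rw [PMF.toMeasure_apply_eq_toOuterMeasure_apply _ (MeasurableSpace.measurableSet_top), rstg,
    PMF.toOuterMeasure_bind_apply, tsum_fintype]
  simp only [PMF.toOuterMeasure_map_apply, Measure.toPMF_apply]

theorem rstg_real_eq_sum (p : unitInterval) (A : Set (TemporalGraph V)) :
    (rstg V p).toMeasure.real A = ∑ G : SimpleGraph V,
      (p : ℝ) ^ G.edgeSet.ncard * (1 - p) ^ ((Nat.card V).choose 2 - G.edgeSet.ncard) *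
        ((ofEdgeOrder G ⁻¹' A).ncard / Nat.card (EdgeOrder G)) := by
  have horder (G : SimpleGraph V) :
      (uniformEdgeOrder G).toOuterMeasure (ofEdgeOrder G ⁻¹' A) =
        (ofEdgeOrder G ⁻¹' A).ncard / Nat.card (EdgeOrder G) := by
    classical
    let _ : Fintype (EdgeOrder G) := Fintype.ofFinite _
    rw [uniformEdgeOrder, PMF.toOuterMeasure_uniformOfFintype_apply, Fintype.card_eq_nat_card,
      Nat.card_coe_set_eq, Fintype.card_eq_nat_card]
  simp_rw [measureReal_def, rstg_toMeasure_eq_sum, horder]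
  rw [ENNReal.toReal_sum fun G _ => ENNReal.mul_ne_top (measure_ne_top _ _) (by
    exact ENNReal.div_ne_top (ENNReal.natCast_ne_top _) (Nat.cast_ne_zero.2 Nat.card_pos.ne'))]
  refine Finset.sum_congr rfl fun G _ => ?_
  rw [ENNReal.toReal_mul, SimpleGraph.binomialRandom_singleton, ENNReal.toReal_div]
  simp

/-- Under independent slots the graph is binomial and, ties being broken at random, its edges are
uniformly ordered. -/
theorem slotLaw_real_le_rstg_real [NeZero N] (p : unitInterval) {S : Set (Sym2 V → Fin (N + 1))}
    {A : Set (TemporalGraph V)}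
    (h : ∀ Y ∈ S, ∀ σ : EdgeOrder (slotGraph Y),
      Refines (fun e : (slotGraph Y).edgeSet => Y e) σ → ofEdgeOrder (slotGraph Y) σ ∈ A) :
    (slotLaw V N p).real S ≤ (rstg V p).toMeasure.real A := by
  classical
  have hp0 : 0 ≤ (p : ℝ) := p.2.1
  have hp1 : 0 ≤ 1 - (p : ℝ) := sub_nonneg.2 p.2.2
  have hN : 0 < (N : ℝ) := Nat.cast_pos.2 (NeZero.pos N)
  rw [rstg_real_eq_sum, ← Set.inter_univ S, ← Set.preimage_univ (f := slotGraph)]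
  rw [← Set.iUnion_of_singleton (SimpleGraph V), Set.preimage_iUnion, Set.inter_iUnion]
  refine (measureReal_iUnion_fintype_le _).trans (Finset.sum_le_sum fun G _ => ?_)
  let B : Set (G.edgeSet → Fin N) := {X | ∀ σ : EdgeOrder G, Refines X σ → ofEdgeOrder G σ ∈ A}
  have hcover : S ∩ slotGraph ⁻¹' {G} ⊆ ⋃ X ∈ B.toFinset,
      {Y | slotGraph Y = G ∧ ∀ e : G.edgeSet, Y e = (X e).castSucc} := by
    rintro Y ⟨hYS, rfl⟩
    have hlt (e : (slotGraph Y).edgeSet) : (Y e : ℕ) < N := (mem_edgeSet_slotGraph.1 e.2).1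
    refine Set.mem_iUnion₂.2
      ⟨fun e => (Y e).castLT (hlt e), Set.mem_toFinset.2 ?_, rfl, fun e => by simp⟩
    exact fun σ hσ => h Y hYS σ fun e e' hee' => hσ (Fin.lt_def.2 hee')
  have hcount : (B.ncard : ℝ) / N ^ G.edgeSet.ncard ≤
      (ofEdgeOrder G ⁻¹' A).ncard / Nat.card (EdgeOrder G) := by
    rw [div_le_div_iff₀ (by positivity) (Nat.cast_pos.2 Nat.card_pos), mul_comm _ ((N : ℝ) ^ _)]
    have := ncard_mul_card_le_of_refines (B := B) (A := ofEdgeOrder G ⁻¹' A) fun X hX => hX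
    rw [Nat.card_fin] at this
    exact_mod_cast this
  calc (slotLaw V N p).real (S ∩ slotGraph ⁻¹' {G})
      ≤ ∑ X ∈ B.toFinset, (slotLaw V N p).real
          {Y | slotGraph Y = G ∧ ∀ e : G.edgeSet, Y e = (X e).castSucc} :=
        (measureReal_mono hcover (measure_ne_top _ _)).trans (measureReal_biUnion_finset_le _ _)
    _ = (p : ℝ) ^ G.edgeSet.ncard * (1 - p) ^ ((Nat.card V).choose 2 - G.edgeSet.ncard) *
          (B.ncard / N ^ G.edgeSet.ncard) := by
        simp only [slotLaw_real_slotGraph_eq_and_slots_eq, Finset.sum_const, nsmul_eq_mul, div_pow,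
          ← Set.ncard_eq_toFinset_card']
        ring
    _ ≤ _ := mul_le_mul_of_nonneg_left hcount (by positivity)

end Slots

section Position

variable {V : Type*} {G : SimpleGraph V}

open scoped Classical in
/-- The position of an edge in the order `σ`, which is its label in `ofEdgeOrder G σ`. A pair that
is not an edge gets the junk value `0`. -/
noncomputable def position (σ : EdgeOrder G) (e : Sym2 V) : ℕ :=
  if h : e ∈ G.edgeSet then σ ⟨e, h⟩ + 1 else 0

theorem position_of_mem (σ : EdgeOrder G) {e : Sym2 V} (h : e ∈ G.edgeSet) :
    position σ e = σ ⟨e, h⟩ + 1 :=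
  dif_pos h

theorem position_le_card (σ : EdgeOrder G) (e : Sym2 V) : position σ e ≤ Nat.card G.edgeSet := by
  unfold position
  split_ifs with h
  · exact (σ ⟨e, h⟩).is_lt
  · exact Nat.zero_le _

theorem reaches_ofEdgeOrder_iff {σ : EdgeOrder G} {u v : V} {t : ℝ} :
    (ofEdgeOrder G σ).Reaches u v t ↔ ∃ p : G.Walk u v, p.IsPath ∧
      p.edges.Pairwise (fun e e' => position σ e < position σ e') ∧
      ∀ e ∈ p.edges, (position σ e : ℝ) ≤ t := by
  have hlabel (p : G.Walk u v) (ℓ : List ℝ) :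
      List.Forall₂ (fun e s => ∃ he : e ∈ (ofEdgeOrder G σ).graph.edgeSet,
        s ∈ (ofEdgeOrder G σ).label ⟨e, he⟩) p.edges ℓ ↔
      p.edges.map (fun e => (position σ e : ℝ)) = ℓ := by
    have hR (e : Sym2 V) (s : ℝ) : (∃ he : e ∈ (ofEdgeOrder G σ).graph.edgeSet,
        s ∈ (ofEdgeOrder G σ).label ⟨e, he⟩) ↔ e ∈ G.edgeSet ∧ (position σ e : ℝ) = s := by
      constructor
      · rintro ⟨he, hs⟩
        exact ⟨he, by rw [position_of_mem σ he, Finset.mem_singleton.1 hs, Nat.cast_succ]; rfl⟩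
      · rintro ⟨he, rfl⟩
        exact ⟨he, Finset.mem_singleton.2 (by rw [position_of_mem σ he, Nat.cast_succ]; rfl)⟩
    simp only [hR]
    rw [List.forall₂_and_left, and_iff_right fun e he => p.edges_subset_edgeSet he,
      ← List.forall₂_eq_eq_eq, List.forall₂_map_left_iff]
  constructor
  · rintro ⟨p, ℓ, hp, hℓ, hlt, ht⟩
    obtain rfl := (hlabel p ℓ).1 hℓ
    refine ⟨p, hp, ?_, ?_⟩
    · simpa [List.pairwise_map] using hlt
    · simpa using ht
  · rintro ⟨p, hp, hlt, ht⟩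
    refine ⟨p, _, hp, (hlabel p _).2 rfl, ?_, ?_⟩
    · simpa [List.pairwise_map] using hlt
    · simpa using ht

variable {N : ℕ} {Y : Sym2 V → Fin (N + 1)} {σ : EdgeOrder (slotGraph Y)}

theorem Refines.position_lt_position
    (hσ : Refines (fun e : (slotGraph Y).edgeSet => Y e) σ) {e e' : Sym2 V}
    (he : e ∈ (slotGraph Y).edgeSet) (he' : e' ∈ (slotGraph Y).edgeSet) (h : Y e < Y e') :
    position σ e < position σ e' := by
  rw [position_of_mem σ he, position_of_mem σ he', Nat.add_lt_add_iff_right]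
  exact hσ (e := ⟨e, he⟩) (e' := ⟨e', he'⟩) h

theorem Refines.reaches_of_pairwise_lt
    (hσ : Refines (fun e : (slotGraph Y).edgeSet => Y e) σ) {u v : V} {p : (slotGraph Y).Walk u v}
    (hp : p.IsPath) (h : p.edges.Pairwise fun e e' => Y e < Y e') :
    (ofEdgeOrder (slotGraph Y) σ).Reaches u v (Nat.card (slotGraph Y).edgeSet : ℕ) :=
  reaches_ofEdgeOrder_iff.2 ⟨p, hp,
    h.imp_of_mem fun he he' =>
      hσ.position_lt_position (p.edges_subset_edgeSet he) (p.edges_subset_edgeSet he'),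
    fun e _ => Nat.cast_le.2 (position_le_card σ e)⟩

theorem Refines.exists_pairwise_le_of_reaches
    (hσ : Refines (fun e : (slotGraph Y).edgeSet => Y e) σ) {u v : V} {t : ℝ}
    (h : (ofEdgeOrder (slotGraph Y) σ).Reaches u v t) :
    ∃ p : (slotGraph Y).Walk u v, p.IsPath ∧ p.edges.Pairwise fun e e' => Y e ≤ Y e' := by
  obtain ⟨p, hp, hlt, -⟩ := reaches_ofEdgeOrder_iff.1 h
  refine ⟨p, hp, hlt.imp_of_mem fun he he' hlt => ?_⟩
  contrapose! hlt
  exact (hσ.position_lt_position (p.edges_subset_edgeSet he') (p.edges_subset_edgeSet he) hlt).le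

end Position

section Explore

variable {V : Type*} [Fintype V] [DecidableEq V] {N : ℕ}

/-- The set `U` together with its neighbours along pairs of `C`. -/
def extend (U : Finset V) (C : Finset (Sym2 V)) : Finset V :=
  {v | v ∈ U ∨ ∃ u ∈ U, s(v, u) ∈ C}

theorem mem_extend {U : Finset V} {C : Finset (Sym2 V)} {v : V} :
    v ∈ extend U C ↔ v ∈ U ∨ ∃ u ∈ U, s(v, u) ∈ C := by
  simp [extend]

theorem subset_extend (U : Finset V) (C : Finset (Sym2 V)) : U ⊆ extend U C :=
  fun _ hv => mem_extend.2 (.inl hv)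

/-- The vertices from which `U` can be reached by passing through slots below `i` in strictly
increasing order. The exploration runs backwards in time, so slot `i - 1` comes first. -/
def revReach (Y : Sym2 V → Fin (N + 1)) : ℕ → Finset V → Finset V
  | 0, U => U
  | i + 1, U => revReach Y i (extend U {e | (Y e : ℕ) = i})

theorem exists_isPath_of_mem_revReach {Y : Sym2 V → Fin (N + 1)} {i : ℕ} (hi : i ≤ N)
    {U : Finset V} {w : V} (hw : w ∈ revReach Y i U) :
    ∃ v ∈ U, ∃ p : (slotGraph Y).Walk w v, p.IsPath ∧ p.edges.Pairwise (fun e e' => Y e < Y e') ∧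
      ∀ e ∈ p.edges, (Y e : ℕ) < i := by
  induction i generalizing U with
  | zero => exact ⟨w, hw, .nil, .nil, by simp, by simp⟩
  | succ i ih =>
    obtain ⟨u, hu, p, hp, hpw, hlt⟩ := ih (by omega) hw
    by_cases huU : u ∈ U
    · exact ⟨u, huU, p, hp, hpw, fun e he => (hlt e he).trans (by omega)⟩
    obtain ⟨v, hv, hY⟩ := (mem_extend.1 hu).resolve_left huU
    rw [Finset.mem_filter_univ] at hY
    refine ⟨v, hv, ?_⟩
    by_cases hvp : v ∈ p.support
    · have hsub : (p.takeUntil v hvp).edges.Sublist p.edges := by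
        conv_rhs => rw [← p.take_spec hvp, SimpleGraph.Walk.edges_append]
        exact List.sublist_append_left _ _
      exact ⟨p.takeUntil v hvp, hp.takeUntil hvp, hpw.sublist hsub,
        fun e he => (hlt e (hsub.subset he)).trans (by omega)⟩
    · have hadj : (slotGraph Y).Adj u v := by
        rw [← SimpleGraph.mem_edgeSet, mem_edgeSet_slotGraph, Sym2.mk_isDiag_iff]
        exact ⟨by omega, fun huv => huU (huv ▸ hv)⟩
      refine ⟨p.concat hadj, hp.concat hvp hadj, ?_, ?_⟩
      · rw [SimpleGraph.Walk.edges_concat, List.concat_eq_append, List.pairwise_append]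
        refine ⟨hpw, List.pairwise_singleton _ _, fun e he e' he' => ?_⟩
        rw [List.mem_singleton.1 he', Fin.lt_def, hY]
        exact hlt e he
      · rw [SimpleGraph.Walk.edges_concat, List.concat_eq_append, List.forall_mem_append,
          List.forall_mem_singleton]
        exact ⟨fun e he => (hlt e he).trans (by omega), by omega⟩

/-- The complement of the ball of a set `S` of size `k` that fails to double contains a set `U` of
`n - 2 k + 1` vertices, and `S` misses everything that `U` is reached from. -/
theorem double_lt_top_of_revReach {Y : Sym2 V → Fin (N + 1)} {σ : EdgeOrder (slotGraph Y)}
    (hσ : Refines (fun e : (slotGraph Y).edgeSet => Y e) σ)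
    (h : ∀ k, 1 ≤ k → 2 * k ≤ Fintype.card V → ∀ U : Finset V,
      U.card = Fintype.card V - 2 * k + 1 → Fintype.card V - k < (revReach Y N U).card) :
    (ofEdgeOrder (slotGraph Y) σ).double < ⊤ := by
  set H := ofEdgeOrder (slotGraph Y) σ
  set T := Nat.card (slotGraph Y).edgeSet
  refine lt_of_le_of_lt (b := (T : ℕ∞)) (iSup₂_le fun S hS => iInf₂_le T ?_) (ENat.natCast_lt_top T)
  by_contra! hlt
  rw [Nat.card_eq_fintype_card] at hS
  classical
  have hcard : Fintype.card V - 2 * S.card + 1 ≤ (H.ball S T)ᶜ.toFinset.card := by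
    have hcompl := Set.ncard_add_ncard_compl (H.ball S T)
    rw [Set.ncard_eq_toFinset_card' (H.ball S T)ᶜ, Nat.card_eq_fintype_card] at hcompl
    omega
  obtain ⟨U, hU, hUcard⟩ := Finset.exists_subset_card_eq hcard
  have hdisj : Disjoint (revReach Y N U) S := by
    rw [Finset.disjoint_left]
    intro w hw hwS
    obtain ⟨v, hv, p, hp, hpw, -⟩ := exists_isPath_of_mem_revReach le_rfl hw
    exact Set.mem_toFinset.1 (hU hv) ⟨w, hwS, hσ.reaches_of_pairwise_lt hp hpw⟩
  have hrev := h S.card (by omega) hS U hUcard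
  have := Finset.card_le_univ (revReach Y N U ∪ S)
  rw [Finset.card_union_of_disjoint hdisj] at this
  omega

end Explore

section Slice

variable {E κ : Type*}

/-- The sides of the part of the box with sides `A e` where, among the coordinates in `D`, exactly
those in `C` take the value `k`. -/
def slice (A : E → Set κ) (D C : Finset E) (k : κ) (e : E) : Set κ :=
  {s ∈ A e | e ∈ D → (s = k ↔ e ∈ C)}

theorem pi_slice [DecidableEq κ] (A : E → Set κ) {D C : Finset E} (hC : C ⊆ D) (k : κ) :
    Set.univ.pi (slice A D C k) = Set.univ.pi A ∩ {Y | {e ∈ D | Y e = k} = C} := by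
  ext Y
  simp only [slice, Set.mem_univ_pi, Set.mem_inter_iff, Set.mem_ofPred_eq,
    forall_and, Finset.ext_iff, Finset.mem_filter]
  refine and_congr_right fun _ => forall_congr' fun e => ?_
  have := @hC e
  tauto

theorem measureReal_pi_inter_eq_sum_slice [Finite E] [Finite κ] [MeasurableSpace κ]
    [DiscreteMeasurableSpace κ] (P : Measure (E → κ)) [IsFiniteMeasure P]
    (A : E → Set κ) (D : Finset E) (k : κ) (T : Set (E → κ)) :
    P.real (Set.univ.pi A ∩ T) =
      ∑ C ∈ D.powerset, P.real (Set.univ.pi (slice A D C k) ∩ T) := by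
  classical
  have hunion : Set.univ.pi A ∩ T = ⋃ C ∈ D.powerset, Set.univ.pi (slice A D C k) ∩ T := by
    ext Y
    simp only [Set.mem_iUnion, Finset.mem_powerset, exists_prop]
    constructor
    · rintro ⟨hA, hT⟩
      refine ⟨{e ∈ D | Y e = k}, Finset.filter_subset _ _, ?_, hT⟩
      rw [pi_slice A (Finset.filter_subset _ _)]
      exact ⟨hA, rfl⟩
    · rintro ⟨C, hC, hY, hT⟩
      rw [pi_slice A hC] at hY
      exact ⟨hY.1, hT⟩
  rw [hunion, measureReal_biUnion_finset _ fun C _ => (Set.toFinite _).measurableSet]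
  intro C hC C' hC' hne
  refine Set.disjoint_left.2 fun Y hY hY' => hne ?_
  have h := (pi_slice A (Finset.mem_powerset.1 hC) k).subset hY.1
  have h' := (pi_slice A (Finset.mem_powerset.1 hC') k).subset hY'.1
  exact h.2.symm.trans h'.2

end Slice

section ExploreProb

variable {V : Type*} [Fintype V] [DecidableEq V] {N : ℕ}

/-- The pairs with exactly one end in `U`. -/
def crossing (U : Finset V) : Finset (Sym2 V) :=
  (U ×ˢ Uᶜ).image fun x => s(x.1, x.2)

theorem mem_crossing {U : Finset V} {e : Sym2 V} :
    e ∈ crossing U ↔ ∃ v ∉ U, ∃ u ∈ U, e = s(v, u) := by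
  simp only [crossing, Finset.mem_image, Finset.mem_product, Finset.mem_compl, Prod.exists]
  constructor
  · rintro ⟨u, v, ⟨hu, hv⟩, rfl⟩
    exact ⟨v, hv, u, hu, Sym2.eq_swap⟩
  · rintro ⟨v, hv, u, hu, rfl⟩
    exact ⟨u, v, ⟨hu, hv⟩, Sym2.eq_swap⟩

theorem card_crossing (U : Finset V) :
    (crossing U).card = U.card * (Fintype.card V - U.card) := by
  rw [crossing, Finset.card_image_of_injOn, Finset.card_product, Finset.card_compl]
  rintro ⟨a, b⟩ hab ⟨c, d⟩ hcd h
  simp only [Finset.coe_product, Set.mem_prod, Finset.mem_coe, Finset.mem_compl] at hab hcd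
  obtain ⟨rfl, rfl⟩ | ⟨rfl, rfl⟩ := Sym2.eq_iff.1 h
  · rfl
  · exact absurd hab.1 hcd.2

theorem extend_inter_crossing (U : Finset V) (C : Finset (Sym2 V)) :
    extend U (crossing U ∩ C) = extend U C := by
  ext v
  rw [mem_extend, mem_extend]
  by_cases hv : v ∈ U
  · simp only [hv, true_or]
  · refine or_congr_right (exists_congr fun u => and_congr_right fun hu => ?_)
    rw [Finset.mem_inter, and_iff_right (mem_crossing.2 ⟨v, hv, u, hu, rfl⟩)]

theorem card_lt_card_extend {U : Finset V} {C : Finset (Sym2 V)} (hC : C ⊆ crossing U)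
    (hne : C.Nonempty) : U.card < (extend U C).card := by
  obtain ⟨e, he⟩ := hne
  obtain ⟨v, hv, u, hu, rfl⟩ := mem_crossing.1 (hC he)
  exact Finset.card_lt_card ((Finset.ssubset_iff_of_subset (subset_extend U C)).2
    ⟨v, mem_extend.2 (.inr ⟨u, hu, he⟩), hv⟩)

theorem revReach_succ_of_filter_crossing_eq {Y : Sym2 V → Fin (N + 1)} {s : Fin (N + 1)}
    {U : Finset V} {C : Finset (Sym2 V)} (hC : {e ∈ crossing U | Y e = s} = C) :
    revReach Y (s + 1) U = revReach Y s (extend U C) := by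
  have : crossing U ∩ ({e | (Y e : ℕ) = s} : Finset (Sym2 V)) = C := by
    rw [← hC]
    ext e
    simp [Fin.ext_iff]
  rw [revReach, ← extend_inter_crossing, this]

theorem pi_slice_inter_revReach_succ (A : Sym2 V → Set (Fin (N + 1))) {U : Finset V}
    {C : Finset (Sym2 V)} (hC : C ⊆ crossing U) (s : Fin (N + 1)) (r : ℕ) :
    Set.univ.pi (slice A (crossing U) C s) ∩ {Y | (revReach Y (s + 1) U).card ≤ r} =
      Set.univ.pi (slice A (crossing U) C s) ∩ {Y | (revReach Y s (extend U C)).card ≤ r} := by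
  ext Y
  refine and_congr_right fun hY => ?_
  rw [pi_slice A hC] at hY
  rw [Set.mem_ofPred_eq, Set.mem_ofPred_eq, revReach_succ_of_filter_crossing_eq hY.2]

theorem mem_slice_of_notMem_extend {A : Sym2 V → Set (Fin (N + 1))} {U : Finset V}
    {C : Finset (Sym2 V)} {s t : Fin (N + 1)} {u v : V} (hA : t ∈ A s(v, u)) (hts : t ≠ s)
    (hv : v ∉ extend U C) : t ∈ slice A (crossing U) C s s(v, u) := by
  refine ⟨hA, fun hD => iff_of_false hts fun hC => hv (mem_extend.2 (.inr ⟨u, ?_, hC⟩))⟩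
  obtain ⟨v', hv', u', hu', h⟩ := mem_crossing.1 hD
  obtain ⟨rfl, rfl⟩ | ⟨rfl, rfl⟩ := Sym2.eq_iff.1 h
  · exact hu'
  · exact absurd (subset_extend _ _ hu') hv

/-- A potential for the exploration, from at least `m` vertices, of a set of `n` vertices in which
each pair is present with probability `q` in each step: `a j` is nonincreasing in the number `j` of
explored vertices, is at least `1` as long as at most `r` vertices are explored, and decreases by
the factor `ρ` in expectation even if each successful step adds only one vertex. -/
structure IsPotential (n : ℕ) (q ρ : ℝ) (m r : ℕ) (a : ℕ → ℝ) : Prop where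
  nonneg : ∀ j, 0 ≤ a j
  one_le : ∀ j, m ≤ j → j ≤ r → 1 ≤ a j
  succ_le : ∀ j, m ≤ j → a (j + 1) ≤ a j
  step : ∀ j, m ≤ j → a (j + 1) + (a j - a (j + 1)) * (1 - q) ^ (j * (n - j)) ≤ ρ * a j

namespace IsPotential

variable {q ρ : ℝ} {m r : ℕ} {a : ℕ → ℝ}

theorem antitone {n : ℕ} (ha : IsPotential n q ρ m r a) {j j' : ℕ} (hj : m ≤ j) (hjj' : j ≤ j') :
    a j' ≤ a j := by
  induction j', hjj' using Nat.le_induction with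
  | base => exact le_rfl
  | succ l hl ih => exact (ha.succ_le l (hj.trans hl)).trans ih

theorem sum_card_extend_mul_le (ha : IsPotential (Fintype.card V) q ρ m r a) {U : Finset V}
    (hU : m ≤ U.card) {mass : Finset (Sym2 V) → ℝ} (hmass : ∀ C, 0 ≤ mass C)
    (hempty : mass ∅ ≤ (1 - q) ^ (crossing U).card * ∑ C ∈ (crossing U).powerset, mass C) :
    ∑ C ∈ (crossing U).powerset, a (extend U C).card * mass C ≤
      ρ * a U.card * ∑ C ∈ (crossing U).powerset, mass C := by
  set M := ∑ C ∈ (crossing U).powerset, mass C with hM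
  have hmem : ∅ ∈ (crossing U).powerset := Finset.empty_mem_powerset _
  have hext : extend U ∅ = U := by ext v; simp [mem_extend]
  have hgain := sub_nonneg.2 (ha.succ_le _ hU)
  calc ∑ C ∈ (crossing U).powerset, a (extend U C).card * mass C
      ≤ a U.card * mass ∅ + ∑ C ∈ (crossing U).powerset.erase ∅, a (U.card + 1) * mass C := by
        rw [← Finset.add_sum_erase _ _ hmem, hext]
        gcongr with C hC
        · exact hmass C
        · rw [Finset.mem_erase, Finset.mem_powerset] at hC
          exact ha.antitone (by omega)
            (card_lt_card_extend hC.2 (Finset.nonempty_iff_ne_empty.2 hC.1))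
    _ = a (U.card + 1) * M + (a U.card - a (U.card + 1)) * mass ∅ := by
        rw [← Finset.mul_sum, hM, ← Finset.add_sum_erase _ _ hmem]
        ring
    _ ≤ a (U.card + 1) * M + (a U.card - a (U.card + 1)) * ((1 - q) ^ (crossing U).card * M) := by
        gcongr
    _ = (a (U.card + 1) + (a U.card - a (U.card + 1)) *
          (1 - q) ^ (U.card * (Fintype.card V - U.card))) * M := by
        rw [card_crossing]
        ring
    _ ≤ ρ * a U.card * M :=
        mul_le_mul_of_nonneg_right (ha.step _ hU) (Finset.sum_nonneg fun C _ => hmass C)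

end IsPotential

variable [NeZero N] {p : unitInterval}

theorem slotLaw_real_pi_slice_empty_le {A : Sym2 V → Set (Fin (N + 1))} {D : Finset (Sym2 V)}
    {s : Fin N} (hA : ∀ e ∈ D, s.castSucc ∈ A e) :
    (slotLaw V N p).real (Set.univ.pi (slice A D ∅ s.castSucc)) ≤
      (1 - p / N) ^ D.card * (slotLaw V N p).real (Set.univ.pi A) := by
  have hpow : ((1 : ℝ) - p / N) ^ D.card = ∏ e, if e ∈ D then 1 - (p : ℝ) / N else 1 := by
    rw [Finset.prod_ite_mem, Finset.univ_inter, Finset.prod_const]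
  rw [slotLaw, measureReal_pi_pi, measureReal_pi_pi, hpow, ← Finset.prod_mul_distrib]
  refine Finset.prod_le_prod (fun e _ => measureReal_nonneg) fun e _ => ?_
  split_ifs with he
  · have hdiff : slice A D ∅ s.castSucc e = A e \ {s.castSucc} := by
      ext t
      simp [slice, he]
    have hle : (slotMeasure N p).real (A e) ≤ 1 := measureReal_le_one
    have hq : 0 ≤ (p : ℝ) / N := div_nonneg p.2.1 N.cast_nonneg
    rw [hdiff, measureReal_sdiff (Set.singleton_subset_iff.2 (hA e he)) (MeasurableSet.singleton _),
      slotMeasure_real_castSucc]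
    nlinarith
  · rw [one_mul]
    exact measureReal_mono (Set.sep_subset _ _)

/-- Revealing slot `i` of the crossing pairs either adds vertices or, with probability at most
`(1 - p / N) ^ |crossing U|`, adds none. The pairs that still matter have not been examined in
earlier slots, which is what the box `A` keeps track of. -/
theorem slotLaw_real_pi_inter_revReach_le {ρ : ℝ} {m r : ℕ} {a : ℕ → ℝ} (hρ : 0 ≤ ρ)
    (ha : IsPotential (Fintype.card V) (p / N) ρ m r a) {i : ℕ} (hi : i ≤ N) {U : Finset V}
    (hU : m ≤ U.card) {A : Sym2 V → Set (Fin (N + 1))}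
    (hA : ∀ v ∉ U, ∀ u, ∀ s : Fin (N + 1), (s : ℕ) < i → s ∈ A s(v, u)) :
    (slotLaw V N p).real (Set.univ.pi A ∩ {Y | (revReach Y i U).card ≤ r}) ≤
      a U.card * ρ ^ i * (slotLaw V N p).real (Set.univ.pi A) := by
  set P := slotLaw V N p
  induction i generalizing U A with
  | zero =>
    by_cases h : U.card ≤ r
    · rw [pow_zero, mul_one]
      exact (measureReal_mono Set.inter_subset_left).trans
        (le_mul_of_one_le_left measureReal_nonneg (ha.one_le _ hU h))
    · simpa [revReach, h] using mul_nonneg (ha.nonneg _) measureReal_nonneg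
  | succ i ih =>
    let s : Fin N := ⟨i, hi⟩
    let mass : Finset (Sym2 V) → ℝ := fun C =>
      P.real (Set.univ.pi (slice A (crossing U) C s.castSucc))
    have hmass : P.real (Set.univ.pi A) = ∑ C ∈ (crossing U).powerset, mass C := by
      simpa using measureReal_pi_inter_eq_sum_slice P A (crossing U) s.castSucc Set.univ
    have hslice : ∀ C ∈ (crossing U).powerset,
        P.real (Set.univ.pi (slice A (crossing U) C s.castSucc) ∩
          {Y | (revReach Y (i + 1) U).card ≤ r}) ≤ a (extend U C).card * ρ ^ i * mass C := by
      intro C hC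
      rw [show i = s.castSucc from rfl, pi_slice_inter_revReach_succ A (Finset.mem_powerset.1 hC)]
      refine ih (by omega) (hU.trans (Finset.card_le_card (subset_extend U C)))
        fun v hv u t ht => mem_slice_of_notMem_extend ?_ (Fin.ne_of_lt ht) hv
      exact hA v (fun h => hv (subset_extend U C h)) u t (by omega)
    have hempty : mass ∅ ≤ (1 - p / N) ^ (crossing U).card * P.real (Set.univ.pi A) := by
      refine slotLaw_real_pi_slice_empty_le fun e he => ?_
      obtain ⟨v, hv, u, -, rfl⟩ := mem_crossing.1 he
      exact hA v hv u _ (by simp [s])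
    rw [hmass] at hempty ⊢
    have hstep := ha.sum_card_extend_mul_le hU (mass := mass) (fun C => measureReal_nonneg) hempty
    calc P.real (Set.univ.pi A ∩ {Y | (revReach Y (i + 1) U).card ≤ r})
        ≤ ∑ C ∈ (crossing U).powerset, a (extend U C).card * ρ ^ i * mass C := by
          rw [measureReal_pi_inter_eq_sum_slice P A (crossing U) s.castSucc]
          exact Finset.sum_le_sum hslice
      _ = ρ ^ i * ∑ C ∈ (crossing U).powerset, a (extend U C).card * mass C := by
          rw [Finset.mul_sum]
          exact Finset.sum_congr rfl fun C _ => by ring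
      _ ≤ ρ ^ i * (ρ * a U.card * ∑ C ∈ (crossing U).powerset, mass C) := by gcongr
      _ = a U.card * ρ ^ (i + 1) * ∑ C ∈ (crossing U).powerset, mass C := by ring

end ExploreProb

theorem one_sub_pow_le_one_sub_mul {q : ℝ} (hq : q ≤ 1) (L : ℕ) {ε : ℝ} (hε : q * L ≤ ε)
    (h0 : 0 ≤ q) : (1 - q) ^ L ≤ 1 - (1 - ε) * (q * L) := by
  have hy : 0 ≤ q * L := by positivity
  have hexp : (1 - q) ^ L ≤ Real.exp (-(q * L)) := by
    have hle : 1 - q ≤ Real.exp (-q) := Real.one_sub_le_exp_neg q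
    calc (1 - q) ^ L ≤ Real.exp (-q) ^ L := pow_le_pow_left₀ (by linarith) hle L
      _ = Real.exp (-(q * L)) := by rw [← Real.exp_nat_mul]; congr 1; ring
  have hinv : Real.exp (-(q * L)) ≤ (1 + q * L)⁻¹ := by
    rw [Real.exp_neg]
    exact inv_anti₀ (by linarith) (by linarith [Real.add_one_le_exp (q * L)])
  have hlin : (1 + q * L)⁻¹ ≤ 1 - (1 - ε) * (q * L) := by
    rw [inv_le_iff_one_le_mul₀ (by linarith)]
    nlinarith [mul_nonneg hy hy, mul_le_mul_of_nonneg_left hε hy, mul_nonneg hy (mul_nonneg hy hy)]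
  exact hexp.trans (hinv.trans hlin)

theorem sum_Ico_one_div_sub_le {x : ℝ} {m R : ℕ} (hx : x < m) (hR : m ≤ R) :
    ∑ l ∈ Finset.Ico m (R + 1), 1 / ((l : ℝ) - x) ≤
      1 / ((m : ℝ) - x) + (Real.log (R - x) - Real.log (m - x)) := by
  induction R, hR using Nat.le_induction with
  | base => simp
  | succ R hR ih =>
    rw [Finset.sum_Ico_succ_top (by omega)]
    have hRx : (0 : ℝ) < R - x := by
      have : (m : ℝ) ≤ R := by exact_mod_cast hR
      linarith
    have key : 1 / (((R + 1 : ℕ) : ℝ) - x) ≤ Real.log ((R + 1 : ℕ) - x) - Real.log (R - x) := by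
      have hpos : (0 : ℝ) < ((R + 1 : ℕ) : ℝ) - x := by push_cast; linarith
      have := Real.one_sub_inv_le_log_of_pos (div_pos hpos hRx)
      rw [Real.log_div hpos.ne' hRx.ne'] at this
      refine le_trans (le_of_eq ?_) this
      rw [inv_div]
      field_simp
      push_cast
      ring
    linarith

theorem sum_Ico_div_sub_le {ε x : ℝ} (hε : 0 < ε) (hx0 : 0 ≤ x) {m r n : ℕ}
    (hm : 1 ≤ m) (hmx : ε * m ≤ m - x) (hmr : m ≤ r) (hrn : r ≤ n) :
    ∑ l ∈ Finset.Ico m r, x / ((l : ℝ) - x) ≤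
      1 / ε + x * (Real.log n - Real.log (ε * m)) := by
  have : (1 : ℝ) ≤ m := by exact_mod_cast hm
  have hmp : 0 < ε * m := by positivity
  have hrn' : (r : ℝ) ≤ n := by exact_mod_cast hrn
  have hmr' : (m : ℝ) ≤ r := by exact_mod_cast hmr
  rcases hmr.eq_or_lt with h | h
  · rw [← h]
    simp only [Finset.Ico_self, Finset.sum_empty]
    have hlog : Real.log (ε * m) ≤ Real.log n := Real.log_le_log hmp (by linarith)
    have := mul_nonneg hx0 (sub_nonneg.2 hlog)
    positivity
  · obtain ⟨R, hR⟩ : ∃ R, r = R + 1 := ⟨r - 1, by omega⟩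
    have hsum := sum_Ico_one_div_sub_le (x := x) (by linarith) (show m ≤ R by omega)
    rw [← hR] at hsum
    have hRm : (m : ℝ) ≤ R := by exact_mod_cast (show m ≤ R by omega)
    have hRr : (R : ℝ) + 1 = r := by rw [hR]; push_cast; ring
    have hlogR : Real.log (R - x) ≤ Real.log n := Real.log_le_log (by linarith) (by linarith)
    have hlogm : Real.log (ε * m) ≤ Real.log (m - x) := Real.log_le_log hmp hmx
    have hfirst : x * (1 / ((m : ℝ) - x)) ≤ 1 / ε := by
      rw [mul_one_div, div_le_div_iff₀ (by linarith) hε]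
      have : x * ε ≤ m * ε := mul_le_mul_of_nonneg_right (by linarith) hε.le
      linarith
    calc ∑ l ∈ Finset.Ico m r, x / ((l : ℝ) - x)
        = x * ∑ l ∈ Finset.Ico m r, 1 / ((l : ℝ) - x) := by
          rw [Finset.mul_sum]; exact Finset.sum_congr rfl fun l _ => by ring
      _ ≤ x * (1 / ((m : ℝ) - x) + (Real.log (R - x) - Real.log (m - x))) := by gcongr
      _ = x * (1 / ((m : ℝ) - x)) + x * (Real.log (R - x) - Real.log (m - x)) := by ring
      _ ≤ 1 / ε + x * (Real.log n - Real.log (ε * m)) := by gcongr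

theorem sum_Ico_div_sub_sub_le {ε x : ℝ} (hε : 0 < ε) (hx0 : 0 ≤ x) {k m n : ℕ} (hk : 1 ≤ k)
    (hkx : ε * k ≤ k - x) (hkn : k ≤ n) (hm : n ≤ m + 2 * k) :
    ∑ l ∈ Finset.Ico m (n - k), x / ((n : ℝ) - l - x) ≤ x / ε := by
  have : (1 : ℝ) ≤ k := by exact_mod_cast hk
  have hterm : ∀ l ∈ Finset.Ico m (n - k), x / ((n : ℝ) - l - x) ≤ x / (ε * k) := by
    intro l hl
    have hln : (l : ℝ) + k ≤ n := by
      exact_mod_cast (show l + k ≤ n by have := Finset.mem_Ico.1 hl; omega)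
    exact div_le_div_of_nonneg_left hx0 (by positivity) (by linarith)
  refine (Finset.sum_le_card_nsmul _ _ _ hterm).trans ?_
  rw [Nat.card_Ico, nsmul_eq_mul]
  have hcard : ((n - k - m : ℕ) : ℝ) ≤ k := by exact_mod_cast (by omega)
  calc ((n - k - m : ℕ) : ℝ) * (x / (ε * k)) ≤ k * (x / (ε * k)) := by gcongr
    _ = x / ε := by field_simp

theorem one_le_one_sub_div_mul_exp {x l L : ℝ} (hx : 0 ≤ x) (hl : x < l) (hL : x < L) :
    1 ≤ (1 - x * (l + L - x) / (l * L)) * Real.exp (x / (l - x) + x / (L - x)) := by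
  have hl' : 0 < l - x := sub_pos.2 hl
  have hL' : 0 < L - x := sub_pos.2 hL
  have hl0 : 0 < l := hx.trans_lt hl
  have hL0 : 0 < L := hx.trans_lt hL
  have hinv : 1 - x * (l + L - x) / (l * L) = ((x / (l - x) + 1) * (x / (L - x) + 1))⁻¹ := by
    field_simp
    ring
  rw [hinv, Real.exp_add, inv_mul_eq_div, one_le_div (by positivity)]
  exact mul_le_mul (Real.add_one_le_exp _) (Real.add_one_le_exp _) (by positivity)
    (Real.exp_nonneg _)

theorem one_sub_pow_mul_sub_le {q ε : ℝ} {n : ℕ} (hq0 : 0 ≤ q) (hq1 : q ≤ 1)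
    (hqn : q * (n : ℝ) ^ 2 ≤ ε) {l : ℕ} (hl : l ≤ n) :
    (1 - q) ^ (l * (n - l)) ≤ 1 - (1 - ε) * (q * (l * (n - l))) := by
  have hcast : ((l * (n - l) : ℕ) : ℝ) = l * (n - l) := by push_cast [Nat.cast_sub hl]; ring
  have hl' : (l : ℝ) ≤ n := by exact_mod_cast hl
  rw [← hcast]
  refine one_sub_pow_le_one_sub_mul hq1 _ ((mul_le_mul_of_nonneg_left ?_ hq0).trans hqn) hq0
  rw [hcast]
  nlinarith [Nat.cast_nonneg (α := ℝ) l]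

/-- The potential of the exploration that is to reach more than `r` of `n` vertices. The factor
`exp (x / (l - x) + x / (n - l - x))` is an upper bound for `(1 - x (n - x) / (l (n - l)))⁻¹`, which
makes the decay rate proportional to `x (n - x)` at every `l`. -/
noncomputable def potential (n r : ℕ) (x : ℝ) (j : ℕ) : ℝ :=
  if j ≤ r then Real.exp (∑ l ∈ Finset.Ico j r, (x / (l - x) + x / (n - l - x))) else 0

section Potential

variable {n m r : ℕ} {q ε x : ℝ}

theorem potential_nonneg (j : ℕ) : 0 ≤ potential n r x j := by
  unfold potential
  split_ifs <;> positivity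

theorem div_sub_add_div_sub_nonneg (hx : 0 ≤ x) (hxm : x ≤ m) (hxr : x + r ≤ n) {l : ℕ}
    (hml : m ≤ l) (hlr : l ≤ r) : 0 ≤ x / ((l : ℝ) - x) + x / ((n : ℝ) - l - x) := by
  have hml' : (m : ℝ) ≤ l := by exact_mod_cast hml
  have hlr' : (l : ℝ) ≤ r := by exact_mod_cast hlr
  exact add_nonneg (div_nonneg hx (by linarith)) (div_nonneg hx (by linarith))

theorem one_le_potential (hx : 0 ≤ x) (hxm : x ≤ m) (hxr : x + r ≤ n) {j : ℕ} (hmj : m ≤ j)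
    (hjr : j ≤ r) : 1 ≤ potential n r x j := by
  rw [potential, if_pos hjr]
  refine Real.one_le_exp (Finset.sum_nonneg fun l hl => ?_)
  rw [Finset.mem_Ico] at hl
  exact div_sub_add_div_sub_nonneg hx hxm hxr (hmj.trans hl.1) hl.2.le

theorem potential_eq_exp_mul {j : ℕ} (hjr : j < r) :
    potential n r x j =
      Real.exp (x / (j - x) + x / (n - j - x)) * potential n r x (j + 1) := by
  rw [potential, if_pos hjr.le, potential, if_pos (by omega : j + 1 ≤ r), ← Real.exp_add,
    Finset.sum_eq_sum_Ico_succ_bot hjr]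

theorem potential_succ_le (hx : 0 ≤ x) (hxm : x ≤ m) (hxr : x + r ≤ n) {j : ℕ} (hmj : m ≤ j) :
    potential n r x (j + 1) ≤ potential n r x j := by
  rcases lt_or_ge j r with hjr | hjr
  · rw [potential_eq_exp_mul hjr]
    exact le_mul_of_one_le_left (potential_nonneg _)
      (Real.one_le_exp (div_sub_add_div_sub_nonneg hx hxm hxr hmj hjr.le))
  · rw [potential, if_neg (by omega)]
    exact potential_nonneg j

theorem one_sub_pow_le_one_sub_rate (hq0 : 0 ≤ q) (hq1 : q ≤ 1) (hqn : q * (n : ℝ) ^ 2 ≤ ε)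
    (hε : ε ≤ 1) {j : ℕ} (hxj : x ≤ j) (hxn : x + j ≤ n) (hjn : j ≤ n) :
    (1 - q) ^ (j * (n - j)) ≤ 1 - (1 - ε) * (q * (x * (n - x))) := by
  have hprod : x * (n - x) ≤ j * (n - j) := by
    nlinarith [mul_nonneg (sub_nonneg.2 hxj) (sub_nonneg.2 hxn)]
  refine (one_sub_pow_mul_sub_le hq0 hq1 hqn hjn).trans (sub_le_sub_left ?_ 1)
  have := sub_nonneg.2 hε
  gcongr

theorem potential_step_of_lt (hq0 : 0 ≤ q) (hq1 : q ≤ 1) (hqn : q * (n : ℝ) ^ 2 ≤ ε) (hx : 0 ≤ x)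
    {j : ℕ} (hxj : x < j) (hxr : x + r ≤ n) (hjr : j < r) :
    potential n r x (j + 1) +
        (potential n r x j - potential n r x (j + 1)) * (1 - q) ^ (j * (n - j)) ≤
      (1 - (1 - ε) * (q * (x * (n - x)))) * potential n r x j := by
  have hjr' : (j : ℝ) < r := by exact_mod_cast hjr
  have hxL : x < n - j := by linarith
  have hj0 : 0 < (j : ℝ) := hx.trans_lt hxj
  have hL0 : 0 < (n : ℝ) - j := hx.trans_lt hxL
  set P := (1 - q) ^ (j * (n - j))
  set t := x * (n - x) / (j * (n - j))
  have hP0 : 0 ≤ 1 - P := sub_nonneg.2 (pow_le_one₀ (by linarith) (by linarith))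
  have hPle : P ≤ 1 - (1 - ε) * (q * (j * (n - j))) :=
    one_sub_pow_mul_sub_le hq0 hq1 hqn (by exact_mod_cast (by linarith : (j : ℝ) ≤ n))
  have hdecay : potential n r x (j + 1) ≤ (1 - t) * potential n r x j := by
    have := one_le_one_sub_div_mul_exp hx hxj hxL
    rw [add_sub_cancel] at this
    rw [potential_eq_exp_mul hjr, ← mul_assoc]
    exact le_mul_of_one_le_left (potential_nonneg _) this
  have htrate : (1 - ε) * (q * (x * (n - x))) ≤ t * (1 - P) := by
    have ht0 : 0 ≤ t := div_nonneg (mul_nonneg hx (by linarith)) (by positivity)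
    calc (1 - ε) * (q * (x * (n - x))) = t * ((1 - ε) * (q * (j * (n - j)))) := by
          simp only [t]; field_simp
      _ ≤ t * (1 - P) := mul_le_mul_of_nonneg_left (by linarith) ht0
  calc potential n r x (j + 1) + (potential n r x j - potential n r x (j + 1)) * P
      = potential n r x j * P + potential n r x (j + 1) * (1 - P) := by ring
    _ ≤ potential n r x j * P + ((1 - t) * potential n r x j) * (1 - P) := by gcongr
    _ = (1 - t * (1 - P)) * potential n r x j := by ring
    _ ≤ (1 - (1 - ε) * (q * (x * (n - x)))) * potential n r x j :=
        mul_le_mul_of_nonneg_right (by linarith) (potential_nonneg j)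

theorem isPotential_potential (hq0 : 0 ≤ q) (hq1 : q ≤ 1) (hqn : q * (n : ℝ) ^ 2 ≤ ε) (hε : ε ≤ 1)
    (hx : 0 ≤ x) (hxm : x < m) (hxr : x + r ≤ n) :
    IsPotential n q (1 - (1 - ε) * (q * (x * (n - x)))) m r (potential n r x) where
  nonneg := potential_nonneg
  one_le _ := one_le_potential hx hxm.le hxr
  succ_le _ := potential_succ_le hx hxm.le hxr
  step j hmj := by
    have hxj : x < j := hxm.trans_le (by exact_mod_cast hmj)
    rcases lt_trichotomy j r with hjr | rfl | hjr
    · exact potential_step_of_lt hq0 hq1 hqn hx hxj hxr hjr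
    · have hjn : j ≤ n := by exact_mod_cast (by linarith : (j : ℝ) ≤ n)
      simpa [potential] using one_sub_pow_le_one_sub_rate hq0 hq1 hqn hε hxj.le hxr hjn
    · simp [potential, hjr.not_ge, show ¬ j + 1 ≤ r by omega]

end Potential

theorem potential_le_exp {ε x : ℝ} (hε : 0 < ε) (hx0 : 0 ≤ x) {n k m : ℕ} (hk : 1 ≤ k)
    (hm : 1 ≤ m) (hmk : m ≤ n - k) (hnm : n ≤ m + 2 * k) (hmx : ε * m ≤ m - x)
    (hkx : ε * k ≤ k - x) :
    potential n (n - k) x m ≤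
      Real.exp (1 / ε + x / ε + x * (Real.log n - Real.log (ε * m))) := by
  rw [potential, if_pos hmk, Finset.sum_add_distrib]
  have hsum := sum_Ico_div_sub_le hε hx0 hm hmx hmk (n.sub_le k)
  have hsum' := sum_Ico_div_sub_sub_le hε hx0 hk hkx (by omega) hnm
  exact Real.exp_le_exp.2 (by linarith)

theorem slotLaw_real_revReach_le_exp {V : Type*} [Fintype V] [DecidableEq V] {N : ℕ} [NeZero N]
    {p : unitInterval} {k : ℕ} (hk : 1 ≤ k) (hkn : 2 * k ≤ Fintype.card V) {ε x : ℝ} (hε : 0 < ε)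
    (hε1 : ε < 1) (hx0 : 0 ≤ x) {U : Finset V} (hU : U.card = Fintype.card V - 2 * k + 1)
    (hxU : x ≤ (1 - ε) * U.card) (hxk : x ≤ (1 - ε) * k)
    (hpN : (p : ℝ) / N * (Fintype.card V : ℝ) ^ 2 ≤ ε) :
    (slotLaw V N p).real {Y | (revReach Y N U).card ≤ Fintype.card V - k} ≤
      Real.exp (1 / ε + x / ε + x * (Real.log (Fintype.card V) - Real.log (ε * U.card)) -
        (1 - ε) * p * (x * (Fintype.card V - x))) := by
  set n := Fintype.card V
  set rate : ℝ := (1 - ε) * (p / N * (x * (n - x)))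
  have hN : (N : ℝ) ≠ 0 := NeZero.ne _
  have hq0 : 0 ≤ (p : ℝ) / N := div_nonneg p.2.1 N.cast_nonneg
  have hq1 : (p : ℝ) / N ≤ 1 :=
    div_le_one_of_le₀ (p.2.2.trans (Nat.one_le_cast.2 NeZero.one_le)) N.cast_nonneg
  have hrR : ((n - k : ℕ) : ℝ) = n - k := Nat.cast_sub (by omega)
  have hUpos : (1 : ℝ) ≤ U.card := by exact_mod_cast (by omega : 1 ≤ U.card)
  have : (1 : ℝ) ≤ k := by exact_mod_cast hk
  have hkn' : (2 : ℝ) * k ≤ n := by exact_mod_cast hkn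
  have hxU' : x < U.card := by nlinarith
  have hxk' : x ≤ k := by nlinarith
  have hρ : 0 ≤ 1 - rate :=
    (pow_nonneg (sub_nonneg.2 hq1) _).trans (one_sub_pow_le_one_sub_rate (j := n - k) hq0 hq1 hpN
      hε1.le (by rw [hrR]; linarith) (by rw [hrR]; linarith) (n.sub_le k))
  have hpot : IsPotential n (p / N) (1 - rate) U.card (n - k) (potential n (n - k) x) :=
    isPotential_potential hq0 hq1 hpN hε1.le hx0 hxU' (by linarith)
  have hprob := slotLaw_real_pi_inter_revReach_le hρ hpot le_rfl le_rfl (A := fun _ => Set.univ)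
    fun _ _ _ _ _ => Set.mem_univ _
  rw [Set.pi_univ, Set.univ_inter, probReal_univ, mul_one] at hprob
  have hpow : (1 - rate) ^ N ≤ Real.exp (-(1 - ε) * p * (x * (n - x))) := by
    calc (1 - rate) ^ N ≤ Real.exp (-rate) ^ N :=
          pow_le_pow_left₀ hρ (Real.one_sub_le_exp_neg _) N
      _ = Real.exp (-(1 - ε) * p * (x * (n - x))) := by
          rw [← Real.exp_nat_mul]; congr 1; simp only [rate]; field_simp
  calc (slotLaw V N p).real {Y | (revReach Y N U).card ≤ n - k}
      ≤ potential n (n - k) x U.card * (1 - rate) ^ N := hprob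
    _ ≤ Real.exp (1 / ε + x / ε + x * (Real.log n - Real.log (ε * U.card))) *
          Real.exp (-(1 - ε) * p * (x * (n - x))) := by
        gcongr
        exact potential_le_exp hε hx0 hk (by omega) (by omega) (by omega) (by linarith)
          (by linarith)
    _ = _ := by rw [← Real.exp_add]; congr 1; ring

section UnionBound

variable {m k n : ℕ}

theorem choose_mul_div_pow_min_le (hm : 1 ≤ m) (hk : 1 ≤ k) (hmk : m + 2 * k = n + 1) :
    (n.choose m : ℝ) * ((n : ℝ) / m) ^ min m k ≤ (3 * (n : ℝ) ^ 2) ^ min m k := by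
  have hm' : (1 : ℝ) ≤ m := by exact_mod_cast hm
  have hn' : (1 : ℝ) ≤ n := by exact_mod_cast (by omega : 1 ≤ n)
  rcases le_total m k with h | h
  · rw [min_eq_left h]
    calc (n.choose m : ℝ) * ((n : ℝ) / m) ^ m ≤ (n : ℝ) ^ m * (n : ℝ) ^ m := by
          gcongr
          · exact_mod_cast Nat.choose_le_pow n m
          · exact div_le_self (by positivity) hm'
      _ = (1 * (n : ℝ) ^ 2) ^ m := by ring
      _ ≤ (3 * (n : ℝ) ^ 2) ^ m := by gcongr; norm_num
  · rw [min_eq_right h]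
    have hchoose : n.choose m ≤ n ^ (2 * k) := by
      rw [← Nat.choose_symm (by omega : m ≤ n)]
      exact (Nat.choose_le_pow n _).trans (Nat.pow_le_pow_right (by omega) (by omega))
    have hdiv : (n : ℝ) / m ≤ 3 := by
      rw [div_le_iff₀ (by positivity)]
      exact_mod_cast (by omega : n ≤ 3 * m)
    calc (n.choose m : ℝ) * ((n : ℝ) / m) ^ k ≤ (n : ℝ) ^ (2 * k) * 3 ^ k := by
          gcongr
          exact_mod_cast hchoose
      _ = (3 * (n : ℝ) ^ 2) ^ k := by ring

theorem choose_mul_div_pow_min_le_of_mul_le (hm : 1 ≤ m) {ε : ℝ} (hε : 0 < ε)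
    (h : ε * n ≤ min m k) :
    (n.choose m : ℝ) * ((n : ℝ) / m) ^ min m k ≤ (Real.exp (1 / ε) / ε) ^ min m k := by
  have hm' : (0 : ℝ) < m := by exact_mod_cast hm
  have hchoose : (n.choose m : ℝ) ≤ Real.exp (1 / ε) ^ min m k := by
    calc (n.choose m : ℝ) ≤ 2 ^ n := by exact_mod_cast Nat.choose_le_two_pow n m
      _ ≤ Real.exp 1 ^ n := by gcongr; linarith [Real.add_one_le_exp (1 : ℝ)]
      _ = Real.exp n := by rw [← Real.exp_nat_mul, mul_one]
      _ ≤ Real.exp ((min m k : ℕ) * (1 / ε)) := by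
          rw [mul_one_div]
          gcongr
          rwa [le_div_iff₀' hε]
      _ = Real.exp (1 / ε) ^ min m k := Real.exp_nat_mul _ _
  have hdiv : (n : ℝ) / m ≤ 1 / ε := by
    rw [div_le_div_iff₀ hm' hε, one_mul, mul_comm]
    exact h.trans (by exact_mod_cast min_le_left m k)
  calc (n.choose m : ℝ) * ((n : ℝ) / m) ^ min m k
      ≤ Real.exp (1 / ε) ^ min m k * (1 / ε) ^ min m k := by gcongr
    _ = (Real.exp (1 / ε) / ε) ^ min m k := by rw [← mul_pow, mul_one_div]

variable {c ε p μ L x : ℝ}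

theorem two_add_half_le (hε : 0 < ε) (hεc : 18 * ε ≤ c) (hc : c ≤ 1) :
    2 + c / 2 ≤ (1 - ε) ^ 3 * (2 + c) := by
  have : 1 - 3 * ε ≤ (1 - ε) ^ 3 := by nlinarith [sq_nonneg ε]
  nlinarith

theorem le_rate_of_le_mul (hε : 0 < ε) (hεc : 18 * ε ≤ c) (hc : c ≤ 1) (hn : 0 < n)
    (hL : 0 ≤ L) (hp : (2 + c) * (L / n) ≤ p) (hμ : 0 ≤ μ) (hμn : μ ≤ ε * n) :
    (2 + c / 2) * (μ * L) ≤ (1 - ε) * p * ((1 - ε) * μ * (n - (1 - ε) * μ)) := by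
  have : (0 : ℝ) < n := by exact_mod_cast hn
  have hε1 : 0 ≤ 1 - ε := by linarith
  have hrest : (1 - ε) * n ≤ n - (1 - ε) * μ := by nlinarith
  have hc0 : 0 < c := by linarith
  have hp0 : 0 ≤ p := (show 0 ≤ (2 + c) * (L / n) by positivity).trans hp
  calc (2 + c / 2) * (μ * L) ≤ (1 - ε) ^ 3 * (2 + c) * (μ * L) := by
        gcongr; exact two_add_half_le hε hεc hc
    _ = (1 - ε) * ((2 + c) * (L / n)) * ((1 - ε) * μ * ((1 - ε) * n)) := by field_simp
    _ ≤ (1 - ε) * p * ((1 - ε) * μ * (n - (1 - ε) * μ)) := by gcongr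

theorem le_rate_of_two_mul_le (hε : 0 < ε) (hεc : 18 * ε ≤ c) (hc : c ≤ 1) (hn : 0 < n)
    (hL : 0 ≤ L) (hp : (2 + c) * (L / n) ≤ p) (hμ : 0 ≤ μ) (hμn : 2 * μ ≤ n) :
    c / 2 * (μ * L) ≤ (1 - ε) * p * ((1 - ε) * μ * (n - (1 - ε) * μ)) := by
  have : (0 : ℝ) < n := by exact_mod_cast hn
  have hε1 : 0 ≤ 1 - ε := by linarith
  have hrest : (n : ℝ) / 2 ≤ n - (1 - ε) * μ := by nlinarith
  have hconst : c / 2 ≤ (1 - ε) ^ 2 * (2 + c) * (1 / 2) := by nlinarith [sq_nonneg ε]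
  have hc0 : 0 < c := by linarith
  have hp0 : 0 ≤ p := (show 0 ≤ (2 + c) * (L / n) by positivity).trans hp
  calc c / 2 * (μ * L) ≤ (1 - ε) ^ 2 * (2 + c) * (1 / 2) * (μ * L) := by gcongr
    _ = (1 - ε) * ((2 + c) * (L / n)) * ((1 - ε) * μ * (n / 2)) := by field_simp
    _ ≤ (1 - ε) * p * ((1 - ε) * μ * (n - (1 - ε) * μ)) := by gcongr

theorem three_le_exp_one_div_div (hε : 0 < ε) (hε3 : 3 * ε ≤ 1) : 3 ≤ Real.exp (1 / ε) / ε := by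
  have hinv : 3 ≤ 1 / ε := by rwa [le_div_iff₀ hε]
  calc (3 : ℝ) ≤ 1 / ε := hinv
    _ ≤ Real.exp (1 / ε) / ε := by gcongr; exact Real.one_le_exp (by positivity)

/-- For few vertices the decay rate `2 + c / 2` beats the `3 n²` choices per vertex; once the number
of vertices is linear in `n` there are only boundedly many choices per vertex, and any positive rate
suffices. -/
theorem choose_mul_pow_mul_exp_le (hm : 1 ≤ m) (hk : 1 ≤ k) (hmk : m + 2 * k = n + 1) (hε : 0 < ε)
    (hεc : 18 * ε ≤ c) (hc : c ≤ 1) (hp : (2 + c) * (Real.log n / n) ≤ p) {μ : ℕ}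
    (hμ : μ = min m k) :
    (n.choose m : ℝ) * ((Real.exp (1 / ε) / ε * (n / m)) ^ μ *
        Real.exp (-((1 - ε) * p * ((1 - ε) * μ * (n - (1 - ε) * μ))))) ≤
      ((Real.exp (1 / ε) / ε) ^ 2 * Real.exp (-(c / 2 * Real.log n))) ^ μ := by
  have hn : 0 < n := by omega
  have hL : 0 ≤ Real.log n := Real.log_natCast_nonneg n
  have hb := three_le_exp_one_div_div hε (by linarith)
  set b := Real.exp (1 / ε) / ε
  set L := Real.log n
  set D := (1 - ε) * p * ((1 - ε) * μ * (n - (1 - ε) * μ))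
  have hexp (d : ℝ) : Real.exp (-(d * (μ * L))) = Real.exp (-(d * L)) ^ μ := by
    rw [← Real.exp_nat_mul]; congr 1; ring
  rcases le_total (μ : ℝ) (ε * n) with hsmall | hlarge
  · have hn2 : (n : ℝ) ^ 2 = Real.exp (2 * L) := by
      rw [two_mul, Real.exp_add, Real.exp_log (by exact_mod_cast hn), sq]
    calc (n.choose m : ℝ) * ((b * (n / m)) ^ μ * Real.exp (-D))
        = b ^ μ * (n.choose m * ((n : ℝ) / m) ^ μ) * Real.exp (-D) := by rw [mul_pow]; ring
      _ ≤ b ^ μ * (3 * (n : ℝ) ^ 2) ^ μ * Real.exp (-((2 + c / 2) * (μ * L))) := by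
          gcongr
          · rw [hμ]; exact choose_mul_div_pow_min_le hm hk hmk
          · exact le_rate_of_le_mul hε hεc hc hn hL hp μ.cast_nonneg hsmall
      _ = (3 * b * Real.exp (-(c / 2 * L))) ^ μ := by
          rw [hexp, ← mul_pow, ← mul_pow, hn2,
            show -((2 + c / 2) * L) = -(2 * L) + -(c / 2 * L) by ring, Real.exp_add, Real.exp_neg]
          field_simp
      _ ≤ (b ^ 2 * Real.exp (-(c / 2 * L))) ^ μ := by
          rw [sq]
          gcongr
  · calc (n.choose m : ℝ) * ((b * (n / m)) ^ μ * Real.exp (-D))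
        = b ^ μ * (n.choose m * ((n : ℝ) / m) ^ μ) * Real.exp (-D) := by rw [mul_pow]; ring
      _ ≤ b ^ μ * b ^ μ * Real.exp (-(c / 2 * (μ * L))) := by
          gcongr
          · rw [hμ] at hlarge ⊢; exact choose_mul_div_pow_min_le_of_mul_le hm hε hlarge
          · exact le_rate_of_two_mul_le hε hεc hc hn hL hp μ.cast_nonneg
              (by exact_mod_cast (by omega : 2 * μ ≤ n))
      _ = (b ^ 2 * Real.exp (-(c / 2 * L))) ^ μ := by rw [hexp]; ring

end UnionBound

theorem sum_pow_le_two_mul {y : ℝ} (hy0 : 0 ≤ y) (hy : y ≤ 1 / 2) (s : Finset ℕ)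
    (hs : ∀ j ∈ s, 1 ≤ j) : ∑ j ∈ s, y ^ j ≤ 2 * y := by
  have hsub : s ⊆ Finset.Ico 1 (s.sup id + 1) := fun j hj =>
    Finset.mem_Ico.2 ⟨hs j hj, Nat.lt_succ_of_le (Finset.le_sup (f := id) hj)⟩
  calc ∑ j ∈ s, y ^ j ≤ ∑ j ∈ Finset.Ico 1 (s.sup id + 1), y ^ j :=
        Finset.sum_le_sum_of_subset_of_nonneg hsub fun j _ _ => by positivity
    _ ≤ y ^ 1 / (1 - y) := geom_sum_Ico_le_of_lt_one hy0 (by linarith)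
    _ ≤ 2 * y := by rw [div_le_iff₀ (by linarith)]; nlinarith

theorem sum_pow_min_le {y : ℝ} (hy0 : 0 ≤ y) (hy : y ≤ 1 / 2) (n : ℕ) :
    ∑ k ∈ Finset.Icc 1 (n / 2), y ^ (min (n - 2 * k + 1) k) ≤ 4 * y := by
  have hinj : Set.InjOn (fun k => n - 2 * k + 1) (Finset.Icc 1 (n / 2)) := by
    intro a ha b hb hab
    simp only [Finset.coe_Icc, Set.mem_Icc] at ha hb hab
    omega
  calc ∑ k ∈ Finset.Icc 1 (n / 2), y ^ (min (n - 2 * k + 1) k)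
      ≤ ∑ k ∈ Finset.Icc 1 (n / 2), (y ^ (n - 2 * k + 1) + y ^ k) := by
        refine Finset.sum_le_sum fun k _ => ?_
        rcases min_choice (n - 2 * k + 1) k with h | h <;> rw [h]
        · exact le_add_of_nonneg_right (by positivity)
        · exact le_add_of_nonneg_left (by positivity)
    _ = ∑ j ∈ (Finset.Icc 1 (n / 2)).image (fun k => n - 2 * k + 1), y ^ j +
        ∑ k ∈ Finset.Icc 1 (n / 2), y ^ k := by
        rw [Finset.sum_add_distrib, Finset.sum_image hinj]
    _ ≤ 2 * y + 2 * y :=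
        add_le_add
          (sum_pow_le_two_mul hy0 hy _ (Finset.forall_mem_image.2 fun _ _ => Nat.le_add_left 1 _))
          (sum_pow_le_two_mul hy0 hy _ fun j hj => (Finset.mem_Icc.1 hj).1)
    _ = 4 * y := by ring

section FiniteDoubling

variable {V : Type*} [Fintype V] [DecidableEq V] {N : ℕ} [NeZero N] {p : unitInterval}

theorem slotLaw_real_revReach_le {k : ℕ} (hk : 1 ≤ k) (hkn : 2 * k ≤ Fintype.card V) {ε : ℝ}
    (hε : 0 < ε) (hε1 : ε < 1) {U : Finset V} (hU : U.card = Fintype.card V - 2 * k + 1)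
    (hpN : (p : ℝ) / N * (Fintype.card V : ℝ) ^ 2 ≤ ε) {μ : ℕ} (hμ : μ = min U.card k) :
    (slotLaw V N p).real {Y | (revReach Y N U).card ≤ Fintype.card V - k} ≤
      Real.exp (1 / ε) * ((Real.exp (1 / ε) / ε * (Fintype.card V / U.card)) ^ μ *
        Real.exp (-((1 - ε) * p * ((1 - ε) * μ * (Fintype.card V - (1 - ε) * μ))))) := by
  set n := Fintype.card V
  have hε1' : 0 ≤ 1 - ε := by linarith
  have hμU : (μ : ℝ) ≤ U.card := by exact_mod_cast hμ ▸ min_le_left _ _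
  have hμk : (μ : ℝ) ≤ k := by exact_mod_cast hμ ▸ min_le_right _ _
  have hUn : (U.card : ℝ) ≤ n := by exact_mod_cast U.card_le_univ
  have hU0 : (0 : ℝ) < U.card := by exact_mod_cast (by omega : 0 < U.card)
  have hn0 : (0 : ℝ) < n := hU0.trans_le hUn
  have hlog : 0 ≤ Real.log n - Real.log (ε * U.card) :=
    sub_nonneg.2 (Real.log_le_log (by positivity) (by nlinarith))
  have hμε : (1 - ε) * μ ≤ μ := by nlinarith [μ.cast_nonneg (α := ℝ)]
  refine (slotLaw_real_revReach_le_exp hk hkn hε hε1 (mul_nonneg hε1' μ.cast_nonneg) hU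
    (mul_le_mul_of_nonneg_left hμU hε1') (mul_le_mul_of_nonneg_left hμk hε1') hpN).trans ?_
  have hpow : (Real.exp (1 / ε) / ε * (n / U.card)) ^ μ =
      Real.exp (μ / ε + μ * (Real.log n - Real.log (ε * U.card))) := by
    rw [← Real.log_div hn0.ne' (by positivity), show μ / ε + μ * Real.log (n / (ε * U.card)) =
      μ * (1 / ε + Real.log (n / (ε * U.card))) by ring, Real.exp_nat_mul, Real.exp_add,
      Real.exp_log (by positivity), div_mul_div_comm, mul_div_assoc]
  rw [hpow, ← Real.exp_add, ← Real.exp_add]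
  refine Real.exp_le_exp.2 ?_
  have hdiv : (1 - ε) * μ / ε ≤ μ / ε := by gcongr
  have hmul := mul_le_mul_of_nonneg_right hμε hlog
  linarith

theorem slotLaw_real_exists_revReach_le {c ε : ℝ} (hε : 0 < ε) (hεc : 18 * ε ≤ c) (hc : c ≤ 1)
    (hpN : (p : ℝ) / N * (Fintype.card V : ℝ) ^ 2 ≤ ε)
    (hp : (2 + c) * (Real.log (Fintype.card V) / Fintype.card V) ≤ p) {y : ℝ}
    (hy : y = (Real.exp (1 / ε) / ε) ^ 2 * Real.exp (-(c / 2 * Real.log (Fintype.card V))))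
    (hy2 : y ≤ 1 / 2) :
    (slotLaw V N p).real {Y | ∃ k, 1 ≤ k ∧ 2 * k ≤ Fintype.card V ∧ ∃ U : Finset V,
        U.card = Fintype.card V - 2 * k + 1 ∧ (revReach Y N U).card ≤ Fintype.card V - k} ≤
      Real.exp (1 / ε) * (4 * y) := by
  set n := Fintype.card V
  let m : ℕ → ℕ := fun k => n - 2 * k + 1
  let bad : Finset V → ℕ → Set (Sym2 V → Fin (N + 1)) := fun U k =>
    {Y | (revReach Y N U).card ≤ n - k}
  have hunion : {Y : Sym2 V → Fin (N + 1) | ∃ k, 1 ≤ k ∧ 2 * k ≤ n ∧ ∃ U : Finset V,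
      U.card = m k ∧ (revReach Y N U).card ≤ n - k} =
      ⋃ k ∈ Finset.Icc 1 (n / 2), ⋃ U ∈ Finset.powersetCard (m k) Finset.univ, bad U k := by
    ext Y
    simp [bad, and_assoc, Nat.le_div_iff_mul_le, mul_comm]
  have hk : ∀ k ∈ Finset.Icc 1 (n / 2),
      (slotLaw V N p).real (⋃ U ∈ Finset.powersetCard (m k) Finset.univ, bad U k) ≤
        Real.exp (1 / ε) * y ^ min (m k) k := by
    intro k hk
    obtain ⟨hk1, hk2⟩ := Finset.mem_Icc.1 hk
    have hsingle : ∀ U ∈ Finset.powersetCard (m k) (Finset.univ : Finset V), _ := fun U hU =>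
      have hUm := (Finset.mem_powersetCard.1 hU).2
      hUm ▸ slotLaw_real_revReach_le hk1 (by omega) hε (by linarith) hUm hpN rfl
    refine (measureReal_biUnion_finset_le _ _).trans
      ((Finset.sum_le_card_nsmul _ _ _ hsingle).trans ?_)
    rw [Finset.card_powersetCard, Finset.card_univ, nsmul_eq_mul, mul_left_comm, hy]
    exact mul_le_mul_of_nonneg_left (choose_mul_pow_mul_exp_le (Nat.le_add_left 1 _) hk1
      (by omega) hε hεc hc hp rfl) (Real.exp_nonneg _)
  calc _ ≤ ∑ k ∈ Finset.Icc 1 (n / 2), Real.exp (1 / ε) * y ^ min (m k) k := by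
        rw [hunion]
        exact (measureReal_biUnion_finset_le _ _).trans (Finset.sum_le_sum hk)
    _ ≤ Real.exp (1 / ε) * (4 * y) := by
        rw [← Finset.mul_sum]
        gcongr
        exact sum_pow_min_le (hy ▸ by positivity) hy2 n

end FiniteDoubling

theorem rstg_real_double_lt_top_ge {V : Type*} [Fintype V] [Nonempty V] {p : unitInterval}
    {c ε : ℝ} (hε : 0 < ε) (hεc : 18 * ε ≤ c) (hc : c ≤ 1) (hn : 1 ≤ ε * Fintype.card V)
    (hp : (2 + c) * (Real.log (Fintype.card V) / Fintype.card V) ≤ p) {y : ℝ}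
    (hy : y = (Real.exp (1 / ε) / ε) ^ 2 * Real.exp (-(c / 2 * Real.log (Fintype.card V))))
    (hy2 : y ≤ 1 / 2) :
    1 - Real.exp (1 / ε) * (4 * y) ≤ (rstg V p).toMeasure.real {H | H.double < ⊤} := by
  classical
  set n := Fintype.card V
  have hn0 : 0 < n := Fintype.card_pos
  have : NeZero (n ^ 3) := ⟨by positivity⟩
  have hpN : (p : ℝ) / (n ^ 3 : ℕ) * (n : ℝ) ^ 2 ≤ ε := by
    have hn' : (0 : ℝ) < n := by exact_mod_cast hn0
    rw [Nat.cast_pow, div_mul_eq_mul_div, div_le_iff₀ (by positivity)]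
    nlinarith [p.2.2, pow_pos hn' 2]
  have hbad := slotLaw_real_exists_revReach_le hε hεc hc hpN hp hy hy2
  set bad : Set (Sym2 V → Fin (n ^ 3 + 1)) := {Y | ∃ k, 1 ≤ k ∧ 2 * k ≤ n ∧ ∃ U : Finset V,
    U.card = n - 2 * k + 1 ∧ (revReach Y (n ^ 3) U).card ≤ n - k}
  calc 1 - Real.exp (1 / ε) * (4 * y) ≤ 1 - (slotLaw V (n ^ 3) p).real bad :=
        sub_le_sub_left hbad 1
    _ = (slotLaw V (n ^ 3) p).real badᶜ :=
        (probReal_compl_eq_one_sub (Set.toFinite _).measurableSet).symm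
    _ ≤ _ := slotLaw_real_le_rstg_real p fun Y hY σ hσ =>
        double_lt_top_of_revReach hσ fun k hk hkn U hU => by
          by_contra! hle
          exact hY ⟨k, hk, hkn, U, hU, hle⟩

theorem tendsto_exp_neg_mul_log_natCast {c : ℝ} (hc : 0 < c) :
    Tendsto (fun n : ℕ => Real.exp (-(c * Real.log n))) atTop (𝓝 0) :=
  Real.tendsto_exp_neg_atTop_nhds_zero.comp
    ((Real.tendsto_log_atTop.comp tendsto_natCast_atTop_atTop).const_mul_atTop hc)

theorem tendsto_rstg_double_lt_top (β : ℕ → unitInterval) {c : ℝ} (hc : 0 < c)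
    (hβ : ∀ᶠ n : ℕ in atTop, (2 + c) * (Real.log n / n) < (β n : ℝ)) :
    Tendsto (fun n : ℕ => (rstg (Fin n) (β n)).toMeasure {H | H.double < ⊤}) atTop (𝓝 1) := by
  set d := min c 1
  have hd0 : 0 < d := lt_min hc one_pos
  set ε := d / 18
  have hε0 : 0 < ε := by positivity
  have hεd : 18 * ε = d := mul_div_cancel₀ d (by norm_num)
  set y : ℕ → ℝ := fun n => (Real.exp (1 / ε) / ε) ^ 2 * Real.exp (-(d / 2 * Real.log n))
  have hy0 : Tendsto y atTop (𝓝 0) := by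
    rw [← mul_zero ((Real.exp (1 / ε) / ε) ^ 2)]
    exact (tendsto_exp_neg_mul_log_natCast (half_pos hd0)).const_mul _
  have hlow : Tendsto (fun n => ENNReal.ofReal (1 - Real.exp (1 / ε) * (4 * y n))) atTop (𝓝 1) := by
    simpa using ENNReal.tendsto_ofReal
      (((hy0.const_mul 4).const_mul (Real.exp (1 / ε))).const_sub 1)
  refine tendsto_of_tendsto_of_tendsto_of_le_of_le' hlow tendsto_const_nhds ?_
    (.of_forall fun n => prob_le_one)
  filter_upwards [hβ, hy0.eventually_le_const (show (0 : ℝ) < 1 / 2 by norm_num),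
    tendsto_natCast_atTop_atTop.eventually_ge_atTop (1 / ε), eventually_gt_atTop 0]
    with n hβn hyn hεn hn
  have : NeZero n := ⟨hn.ne'⟩
  rw [div_le_iff₀' hε0] at hεn
  refine ENNReal.ofReal_le_of_le_toReal (rstg_real_double_lt_top_ge hε0 hεd.le
    (min_le_right c 1) (by simpa using hεn) ?_ (by rw [Fintype.card_fin]) hyn)
  rw [Fintype.card_fin]
  refine le_trans ?_ hβn.le
  gcongr
  exact min_le_left c 1

section Late

variable {V : Type*} {K k : ℕ}

/-- The slots in the second half of the time interval. -/
def lateSlots (K : ℕ) : Set (Fin (2 * K + 1)) := {s | K ≤ s ∧ (s : ℕ) < 2 * K}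

/-- No edge at `v` is in a late slot. For convenience this also constrains the slot of the diagonal
pair `s(v, v)`, although it does not matter for the graph. -/
def LateIsolated (Y : Sym2 V → Fin (2 * K + 1)) (v : V) : Prop :=
  ∀ u, Y s(u, v) ∉ lateSlots K

/-- The `j`-th pair of the sequence of vertices `f 0, …, f k`. -/
def chainEdge (f : Fin (k + 1) → V) (j : Fin k) : Sym2 V := s(f j.castSucc, f j.succ)

theorem chainEdge_injective {f : Fin (k + 1) → V} (hf : f.Injective) :
    (chainEdge f).Injective := by
  intro i j hij
  rcases Sym2.eq_iff.1 hij with ⟨h, -⟩ | ⟨h, h'⟩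
  · exact Fin.castSucc_injective k (hf h)
  · have h₁ := congrArg Fin.val (hf h)
    have h₂ := congrArg Fin.val (hf h')
    simp only [Fin.val_castSucc, Fin.val_succ] at h₁ h₂
    omega

theorem succ_eq_last_of_last_mem_chainEdge {f : Fin (k + 1) → V} (hf : f.Injective) {j : Fin k}
    (h : f (Fin.last k) ∈ chainEdge f j) : j.succ = Fin.last k := by
  rcases Sym2.mem_iff.1 h with h | h
  · exact absurd (hf h).symm (Fin.castSucc_ne_last j)
  · exact (hf h).symm

/-- The distinct vertices `f 0, …, f k` are passed through in nondecreasing slots of the first half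
of the time interval. -/
structure IsEarlyChain (Y : Sym2 V → Fin (2 * K + 1)) (f : Fin (k + 1) → V) : Prop where
  injective : f.Injective
  monotone : Monotone (Y ∘ chainEdge f)
  lt : ∀ j, (Y (chainEdge f j) : ℕ) < K

theorem exists_isEarlyChain_of_reaches {Y : Sym2 V → Fin (2 * K + 1)} {σ : EdgeOrder (slotGraph Y)}
    (hσ : Refines (fun e : (slotGraph Y).edgeSet => Y e) σ) {u v : V} {t : ℝ}
    (hv : LateIsolated Y v) (h : (ofEdgeOrder (slotGraph Y) σ).Reaches u v t) :
    ∃ (k : ℕ) (f : Fin (k + 1) → V), IsEarlyChain Y f ∧ f 0 = u ∧ f (Fin.last k) = v := by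
  obtain ⟨p, hp, hpw⟩ := hσ.exists_pairwise_le_of_reaches h
  let f : Fin (p.length + 1) → V := fun j => p.getVert j
  have hedge (j : Fin p.length) : p.edges[j]'(by simp) = chainEdge f j := p.getElem_edges ..
  have hmono : Monotone (Y ∘ chainEdge f) := by
    intro i j hij
    rcases hij.eq_or_lt with rfl | hlt
    · exact le_rfl
    · rw [Function.comp_apply, Function.comp_apply, ← hedge, ← hedge]
      exact List.pairwise_iff_getElem.1 hpw i j (by simp) (by simp) hlt
  refine ⟨p.length, f, ⟨fun i j hij => Fin.ext (hp.getVert_injOn i.is_le j.is_le hij), hmono,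
    fun j => ?_⟩, p.getVert_zero, p.getVert_length⟩
  let l : Fin p.length := ⟨p.length - 1, Nat.sub_one_lt_of_lt j.is_lt⟩
  have hl : chainEdge f l = s(f l.castSucc, v) := by
    have : f l.succ = v := by
      simp only [f, l, Fin.succ_mk, Nat.sub_add_cancel j.pos, p.getVert_length]
    rw [chainEdge, this]
  have hlN : (Y (chainEdge f l) : ℕ) < 2 * K :=
    (mem_edgeSet_slotGraph.1 (p.adj_getVert_succ l.is_lt)).1
  have hlK : (Y (chainEdge f l) : ℕ) < K := by
    have := hv (f l.castSucc)
    rw [← hl] at this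
    exact not_le.1 fun hK => this ⟨hK, hlN⟩
  exact lt_of_le_of_lt (hmono (Fin.le_def.2 (Nat.le_sub_one_of_lt j.is_lt))) hlK

variable [Fintype V]

open scoped Classical in
/-- The vertices from which some early chain leads to `v`. -/
noncomputable def earlyReach (Y : Sym2 V → Fin (2 * K + 1)) (v : V) : Finset V :=
  {u | ∃ (k : ℕ) (f : Fin (k + 1) → V), IsEarlyChain Y f ∧ f 0 = u ∧ f (Fin.last k) = v}

theorem mem_earlyReach {Y : Sym2 V → Fin (2 * K + 1)} {u v : V} :
    u ∈ earlyReach Y v ↔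
      ∃ (k : ℕ) (f : Fin (k + 1) → V), IsEarlyChain Y f ∧ f 0 = u ∧ f (Fin.last k) = v := by
  simp [earlyReach]

/-- Half of the vertices reach neither `v` nor `w`, so the ball of that half never has more than
`n - 2` elements. -/
theorem double_eq_top_of_lateIsolated {Y : Sym2 V → Fin (2 * K + 1)}
    {σ : EdgeOrder (slotGraph Y)} (hσ : Refines (fun e : (slotGraph Y).edgeSet => Y e) σ)
    {v w : V} (hne : v ≠ w) (hv : LateIsolated Y v) (hw : LateIsolated Y w)
    (hrv : 4 * (earlyReach Y v).card ≤ Fintype.card V)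
    (hrw : 4 * (earlyReach Y w).card ≤ Fintype.card V) :
    (ofEdgeOrder (slotGraph Y) σ).double = ⊤ := by
  classical
  set H := ofEdgeOrder (slotGraph Y) σ
  have hcard : Fintype.card V / 2 ≤ ((earlyReach Y v ∪ earlyReach Y w)ᶜ).card := by
    rw [Finset.card_compl]
    have := Finset.card_union_le (earlyReach Y v) (earlyReach Y w)
    omega
  obtain ⟨S, hS, hSc⟩ := Finset.exists_subset_card_eq hcard
  have hball (t : ℕ) : H.ball S t ⊆ ↑({v, w} : Finset V)ᶜ := by
    rintro x ⟨u, hu, hr⟩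
    have hu' := hS hu
    rw [Finset.mem_compl, Finset.mem_union, not_or, mem_earlyReach, mem_earlyReach] at hu'
    rw [Finset.coe_compl, Set.mem_compl_iff, Finset.mem_coe, Finset.mem_insert,
      Finset.mem_singleton]
    rintro (rfl | rfl)
    · exact hu'.1 (exists_isEarlyChain_of_reaches hσ hv hr)
    · exact hu'.2 (exists_isEarlyChain_of_reaches hσ hw hr)
  have htop : H.doubleOf S = ⊤ := by
    refine iInf₂_eq_top.2 fun t ht => ?_
    have hle := Set.ncard_le_ncard (hball t) (Finset.finite_toSet _)
    rw [Set.ncard_coe_finset, Finset.card_compl, Finset.card_pair hne] at hle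
    have := Finset.card_pair hne ▸ Finset.card_le_univ ({v, w} : Finset V)
    omega
  rw [eq_top_iff, ← htop]
  refine le_iSup₂ (f := fun (S : Finset V) (_ : 2 * S.card ≤ Nat.card V) => H.doubleOf S) S ?_
  rw [Nat.card_eq_fintype_card]
  omega

end Late

section SecondMoment

variable {Ω ι : Type*} [Fintype ι]

open scoped Classical in
theorem card_filter_mem_eq_sum_indicator (A : ι → Set Ω) (ω : Ω) :
    ((Finset.univ.filter fun i => ω ∈ A i).card : ℝ) =
      ∑ i, (A i).indicator (fun _ => (1 : ℝ)) ω := by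
  simp only [Set.indicator_apply, Finset.sum_boole]

variable [MeasurableSpace Ω] {μ : Measure Ω}

open scoped Classical in
theorem integral_card_filter_mem [IsFiniteMeasure μ] {A : ι → Set Ω}
    (hA : ∀ i, MeasurableSet (A i)) :
    ∫ ω, ((Finset.univ.filter fun i => ω ∈ A i).card : ℝ) ∂μ = ∑ i, μ.real (A i) := by
  simp_rw [card_filter_mem_eq_sum_indicator]
  rw [integral_finsetSum _ fun i _ => (integrable_const 1).indicator (hA i)]
  exact Finset.sum_congr rfl fun i _ => integral_indicator_one (hA i)

open scoped Classical in
theorem measureReal_le_card_filter_mem_le [IsFiniteMeasure μ] {A : ι → Set Ω}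
    (hA : ∀ i, MeasurableSet (A i)) {t : ℝ} (ht : 0 < t) :
    μ.real {ω | t ≤ (Finset.univ.filter fun i => ω ∈ A i).card} ≤ (∑ i, μ.real (A i)) / t := by
  rw [le_div_iff₀' ht, ← integral_card_filter_mem hA]
  refine mul_meas_ge_le_integral_of_nonneg (.of_forall fun _ => Nat.cast_nonneg _) ?_ t
  simp_rw [card_filter_mem_eq_sum_indicator]
  exact integrable_finsetSum _ fun i _ => (integrable_const 1).indicator (hA i)

open scoped Classical in
theorem integral_sq_card_filter_mem [IsFiniteMeasure μ] {A : ι → Set Ω}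
    (hA : ∀ i, MeasurableSet (A i)) :
    ∫ ω, ((Finset.univ.filter fun i => ω ∈ A i).card : ℝ) ^ 2 ∂μ =
      ∑ i, ∑ j, μ.real (A i ∩ A j) := by
  have hInt (i j : ι) : Integrable ((A i ∩ A j).indicator fun _ => (1 : ℝ)) μ :=
    (integrable_const 1).indicator ((hA i).inter (hA j))
  have hsq (ω : Ω) : ((Finset.univ.filter fun i => ω ∈ A i).card : ℝ) ^ 2 =
      ∑ i, ∑ j, (A i ∩ A j).indicator (fun _ => (1 : ℝ)) ω := by
    rw [card_filter_mem_eq_sum_indicator, sq, Finset.sum_mul_sum]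
    exact Finset.sum_congr rfl fun i _ => Finset.sum_congr rfl fun j _ =>
      (congrFun (Set.inter_indicator_one (M₀ := ℝ)) ω).symm
  simp_rw [hsq]
  rw [integral_finsetSum _ fun i _ => integrable_finsetSum _ fun j _ => hInt i j]
  refine Finset.sum_congr rfl fun i _ => ?_
  rw [integral_finsetSum _ fun j _ => hInt i j]
  exact Finset.sum_congr rfl fun j _ => integral_indicator_one ((hA i).inter (hA j))

open scoped Classical in
theorem measureReal_two_mul_card_filter_mem_le [IsProbabilityMeasure μ] {A : ι → Set Ω}
    (hA : ∀ i, MeasurableSet (A i)) {m : ℝ} (hm : 0 < m) (hsum : ∑ i, μ.real (A i) = m) :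
    μ.real {ω | 2 * ((Finset.univ.filter fun i => ω ∈ A i).card : ℝ) ≤ m} ≤
      4 * (∑ i, ∑ j, μ.real (A i ∩ A j) - m ^ 2) / m ^ 2 := by
  set X : Ω → ℝ := fun ω => (Finset.univ.filter fun i => ω ∈ A i).card
  have hXsum : X = fun ω => ∑ i, (A i).indicator (fun _ => (1 : ℝ)) ω :=
    funext (card_filter_mem_eq_sum_indicator A)
  have hX : MemLp X 2 μ := by
    rw [hXsum]
    exact memLp_finsetSum _ fun i _ => (memLp_const 1).indicator (hA i)
  have hmean : ∫ ω, X ω ∂μ = m := (integral_card_filter_mem hA).trans hsum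
  have hvar : ProbabilityTheory.variance X μ = ∑ i, ∑ j, μ.real (A i ∩ A j) - m ^ 2 := by
    rw [ProbabilityTheory.variance_eq_sub hX, hmean, ← integral_sq_card_filter_mem hA]
    rfl
  have hsub : {ω | 2 * X ω ≤ m} ⊆ {ω | m / 2 ≤ |X ω - ∫ ω, X ω ∂μ|} := fun ω hω => by
    rw [Set.mem_ofPred_eq] at hω ⊢
    rw [hmean, abs_sub_comm]
    exact le_trans (by linarith) (le_abs_self _)
  calc μ.real {ω | 2 * X ω ≤ m} ≤ ProbabilityTheory.variance X μ / (m / 2) ^ 2 :=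
        ENNReal.toReal_le_of_le_ofReal
          (div_nonneg (ProbabilityTheory.variance_nonneg _ _) (by positivity))
          ((measure_mono hsub).trans
            (ProbabilityTheory.meas_ge_le_variance_div_sq hX (half_pos hm)))
    _ = 4 * (∑ i, ∑ j, μ.real (A i ∩ A j) - m ^ 2) / m ^ 2 := by rw [hvar]; field_simp; ring

end SecondMoment

section Multichoose

open scoped Classical in
theorem card_monotone_le_multichoose (K k : ℕ) :
    (Finset.univ.filter fun g : Fin k → Fin K => Monotone g).card ≤ K.multichoose k := by
  rw [← Fintype.card_fin K, ← Sym.card_sym_eq_multichoose, Fintype.card_fin, ← Finset.card_univ]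
  refine Finset.card_le_card_of_injOn
    (fun g => (⟨(List.ofFn g : Multiset (Fin K)), by simp⟩ : Sym (Fin K) k))
    (fun _ _ => Finset.mem_coe.2 (Finset.mem_univ _)) fun g hg g' hg' h => ?_
  have hperm : (List.ofFn g).Perm (List.ofFn g') := Multiset.coe_eq_coe.1 (congrArg Subtype.val h)
  rw [Finset.mem_coe, Finset.mem_filter_univ] at hg hg'
  exact List.ofFn_injective (hperm.eq_of_pairwise' hg.sortedLE_ofFn.pairwise
    hg'.sortedLE_ofFn.pairwise)

theorem sum_multichoose_mul_pow_le {x : ℝ} (hx0 : 0 ≤ x) (hx1 : x < 1) {K : ℕ} (hK : 0 < K)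
    (s : Finset ℕ) : ∑ k ∈ s, (K.multichoose k : ℝ) * x ^ k ≤ ((1 - x)⁻¹) ^ K := by
  obtain ⟨K, rfl⟩ := Nat.exists_eq_succ_of_ne_zero hK.ne'
  have hsum := hasSum_choose_mul_geometric_of_norm_lt_one K
    (show ‖x‖ < 1 by rwa [Real.norm_of_nonneg hx0])
  rw [inv_pow, ← one_div]
  refine le_trans (le_of_eq (Finset.sum_congr rfl fun k _ => ?_))
    (sum_le_hasSum s (fun k _ => by positivity) hsum)
  rw [Nat.multichoose_eq, ← Nat.choose_symm_add, add_comm k]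
  congr 3
  omega

end Multichoose

section InfiniteDoubling

variable {V : Type*} [Fintype V] [DecidableEq V]

theorem slotLaw_real_forall_mem {N : ℕ} [NeZero N] (p : unitInterval) (A : Finset (Sym2 V))
    (B : Sym2 V → Set (Fin (N + 1))) :
    (slotLaw V N p).real {Y | ∀ e ∈ A, Y e ∈ B e} = ∏ e ∈ A, (slotMeasure N p).real (B e) := by
  have hbox : {Y : Sym2 V → Fin (N + 1) | ∀ e ∈ A, Y e ∈ B e} =
      Set.univ.pi fun e => if e ∈ A then B e else Set.univ := by
    ext Y
    simp [Set.mem_pi, Set.mem_ite_univ_right]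
  rw [hbox, slotLaw, measureReal_pi_pi]
  simp only [apply_ite (slotMeasure N p).real, probReal_univ, Finset.prod_ite_mem,
    Finset.univ_inter]

/-- The pairs containing `v`, including the diagonal one. -/
def star (v : V) : Finset (Sym2 V) := Finset.univ.image fun u => s(u, v)

theorem mem_star {v : V} {e : Sym2 V} : e ∈ star v ↔ v ∈ e := by
  simp only [star, Finset.mem_image, Finset.mem_univ, true_and, Sym2.mem_iff_exists]
  exact exists_congr fun u => by rw [Sym2.eq_swap, eq_comm]

theorem card_star (v : V) : (star v).card = Fintype.card V :=
  Finset.card_image_of_injective _ fun _ _ => Sym2.congr_left.1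

theorem card_star_union_star {v w : V} (h : v ≠ w) :
    (star v ∪ star w).card = 2 * Fintype.card V - 1 := by
  have hinter : star v ∩ star w = {s(v, w)} := by
    ext e
    rw [Finset.mem_inter, mem_star, mem_star, Finset.mem_singleton, Sym2.mem_and_mem_iff h]
  rw [Finset.card_union, hinter, card_star, card_star, Finset.card_singleton, two_mul]

theorem lateIsolated_iff {K : ℕ} {Y : Sym2 V → Fin (2 * K + 1)} {v : V} :
    LateIsolated Y v ↔ ∀ e ∈ star v, Y e ∈ (lateSlots K)ᶜ := by
  simp only [LateIsolated, star, Finset.forall_mem_image, Finset.mem_univ, true_imp_iff,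
    Set.mem_compl_iff]

theorem card_sub_one_le_card_star_sdiff_image_chainEdge {k : ℕ} {f : Fin (k + 1) → V}
    (hf : f.Injective) : Fintype.card V - 1 ≤
      (star (f (Fin.last k)) \ Finset.univ.image (chainEdge f)).card := by
  have hone : (Finset.univ.image (chainEdge f) ∩ star (f (Fin.last k))).card ≤ 1 := by
    refine Finset.card_le_one.2 fun a ha b hb => ?_
    simp only [Finset.mem_inter, Finset.mem_image, mem_star] at ha hb
    obtain ⟨⟨i, -, rfl⟩, hi⟩ := ha
    obtain ⟨⟨j, -, rfl⟩, hj⟩ := hb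
    rw [Fin.succ_injective k ((succ_eq_last_of_last_mem_chainEdge hf hi).trans
      (succ_eq_last_of_last_mem_chainEdge hf hj).symm)]
  rw [Finset.card_sdiff, card_star]
  omega

variable {K : ℕ} [NeZero K] {p : unitInterval}

theorem slotMeasure_real_lateSlots (p : unitInterval) :
    (slotMeasure (2 * K) p).real (lateSlots K) = p / 2 := by
  classical
  have hcard : (Finset.univ.filter fun s : Fin (2 * K) => s.castSucc ∈ lateSlots K).card = K := by
    have : (Finset.univ.filter fun s : Fin (2 * K) => s.castSucc ∈ lateSlots K).map
        Fin.valEmbedding = Finset.Ico K (2 * K) := by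
      ext s
      rw [Finset.mem_map, Finset.mem_Ico]
      refine ⟨fun ⟨i, hi, his⟩ => ?_, fun hs => ⟨⟨s, hs.2⟩, (Finset.mem_filter_univ _).2 hs, rfl⟩⟩
      rw [← his]
      exact (Finset.mem_filter.1 hi).2
    rw [← Finset.card_map Fin.valEmbedding, this, Nat.card_Ico]
    omega
  have hlast : Fin.last (2 * K) ∉ lateSlots K := fun h => lt_irrefl _ h.2
  rw [slotMeasure_real_apply, hcard, if_neg hlast, add_zero, Nat.cast_mul, Nat.cast_two]
  have : (K : ℝ) ≠ 0 := Nat.cast_ne_zero.2 (NeZero.ne K)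
  field_simp

instance : NeZero (2 * K) := ⟨mul_ne_zero two_ne_zero (NeZero.ne K)⟩

theorem slotMeasure_real_compl_lateSlots (p : unitInterval) :
    (slotMeasure (2 * K) p).real (lateSlots K)ᶜ = 1 - p / 2 := by
  rw [probReal_compl_eq_one_sub (Set.toFinite _).measurableSet, slotMeasure_real_lateSlots]

theorem slotLaw_real_forall_notMem_lateSlots (p : unitInterval) (A : Finset (Sym2 V)) :
    (slotLaw V (2 * K) p).real {Y | ∀ e ∈ A, Y e ∈ (lateSlots K)ᶜ} = (1 - p / 2) ^ A.card := by
  rw [slotLaw_real_forall_mem, slotMeasure_real_compl_lateSlots, Finset.prod_const]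

theorem slotLaw_real_lateIsolated (p : unitInterval) (v : V) :
    (slotLaw V (2 * K) p).real {Y | LateIsolated Y v} = (1 - p / 2) ^ Fintype.card V := by
  simp_rw [lateIsolated_iff]
  rw [slotLaw_real_forall_notMem_lateSlots, card_star]

theorem slotLaw_real_lateIsolated_inter (p : unitInterval) {v w : V} (h : v ≠ w) :
    (slotLaw V (2 * K) p).real ({Y | LateIsolated Y v} ∩ {Y | LateIsolated Y w}) =
      (1 - p / 2) ^ (2 * Fintype.card V - 1) := by
  simp_rw [lateIsolated_iff, ← Set.ofPred_and, ← Finset.forall_mem_union]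
  rw [slotLaw_real_forall_notMem_lateSlots, card_star_union_star h]

theorem slotLaw_real_lateIsolated_inter_chain_le {k : ℕ} {f : Fin (k + 1) → V} (hf : f.Injective)
    (g : Fin k → Fin (2 * K)) :
    (slotLaw V (2 * K) p).real {Y | LateIsolated Y (f (Fin.last k)) ∧
        ∀ j, Y (chainEdge f j) = (g j).castSucc} ≤
      ((p : ℝ) / (2 * K)) ^ k * (1 - p / 2) ^ (Fintype.card V - 1) := by
  have hinj := chainEdge_injective hf
  let T : Finset (Sym2 V) := Finset.univ.image (chainEdge f)
  let R : Finset (Sym2 V) := star (f (Fin.last k)) \ T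
  let B : Sym2 V → Set (Fin (2 * K + 1)) :=
    Function.extend (chainEdge f) (fun j => {(g j).castSucc}) fun _ => (lateSlots K)ᶜ
  have hBT (j : Fin k) : B (chainEdge f j) = {(g j).castSucc} := hinj.extend_apply _ _ j
  have hBR : ∀ e ∈ R, B e = (lateSlots K)ᶜ := fun e he =>
    Function.extend_apply' _ _ _ fun ⟨j, hj⟩ =>
      (Finset.mem_sdiff.1 he).2 (Finset.mem_image.2 ⟨j, Finset.mem_univ _, hj⟩)
  have hsub : {Y | LateIsolated Y (f (Fin.last k)) ∧ ∀ j, Y (chainEdge f j) = (g j).castSucc} ⊆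
      {Y | ∀ e ∈ T ∪ R, Y e ∈ B e} := by
    rintro Y ⟨hlate, hchain⟩ e he
    rcases Finset.mem_union.1 he with heT | heR
    · obtain ⟨j, -, rfl⟩ := Finset.mem_image.1 heT
      rw [hBT, Set.mem_singleton_iff, hchain]
    · rw [hBR e heR]
      exact lateIsolated_iff.1 hlate e (Finset.mem_sdiff.1 heR).1
  have hp1 : 0 ≤ 1 - (p : ℝ) / 2 := by linarith [p.2.2]
  calc _ ≤ (slotLaw V (2 * K) p).real {Y | ∀ e ∈ T ∪ R, Y e ∈ B e} :=
        measureReal_mono hsub (measure_ne_top _ _)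
    _ = ((p : ℝ) / (2 * K)) ^ k * (1 - p / 2) ^ R.card := by
        rw [slotLaw_real_forall_mem, Finset.prod_union Finset.disjoint_sdiff,
          Finset.prod_image hinj.injOn,
          Finset.prod_congr (s₁ := R) rfl fun e he => by rw [hBR e he]]
        simp only [hBT, slotMeasure_real_castSucc, slotMeasure_real_compl_lateSlots,
          Finset.prod_const, Finset.card_univ, Fintype.card_fin, Nat.cast_mul, Nat.cast_two]
    _ ≤ _ := mul_le_mul_of_nonneg_left
        (pow_le_pow_of_le_one hp1 (by linarith [p.2.1])
          (card_sub_one_le_card_star_sdiff_image_chainEdge hf)) (by have := p.2.1; positivity)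

theorem slotLaw_real_lateIsolated_inter_isEarlyChain_le {k : ℕ} {v : V} {f : Fin (k + 1) → V}
    (hfv : f (Fin.last k) = v) :
    (slotLaw V (2 * K) p).real {Y | LateIsolated Y v ∧ IsEarlyChain Y f} ≤
      K.multichoose k * (((p : ℝ) / (2 * K)) ^ k * (1 - p / 2) ^ (Fintype.card V - 1)) := by
  classical
  have hb : 0 ≤ ((p : ℝ) / (2 * K)) ^ k * (1 - p / 2) ^ (Fintype.card V - 1) :=
    mul_nonneg (pow_nonneg (div_nonneg p.2.1 (by positivity)) _)
      (pow_nonneg (by linarith [p.2.2]) _)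
  by_cases hf : f.Injective
  swap
  · have : {Y : Sym2 V → Fin (2 * K + 1) | LateIsolated Y v ∧ IsEarlyChain Y f} = ∅ :=
      Set.eq_empty_of_forall_notMem fun Y hY => hf hY.2.injective
    rw [this, measureReal_empty]
    positivity
  subst hfv
  let cast : Fin K → Fin (2 * K) := Fin.castLE (by omega)
  have hsub : {Y : Sym2 V → Fin (2 * K + 1) | LateIsolated Y (f (Fin.last k)) ∧
      IsEarlyChain Y f} ⊆ ⋃ g ∈ Finset.univ.filter fun g : Fin k → Fin K => Monotone g,
      {Y | LateIsolated Y (f (Fin.last k)) ∧ ∀ j, Y (chainEdge f j) = (cast (g j)).castSucc} := by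
    rintro Y ⟨hlate, hchain⟩
    exact Set.mem_iUnion₂.2 ⟨fun j => ⟨Y (chainEdge f j), hchain.lt j⟩,
      (Finset.mem_filter_univ _).2 fun i j hij => hchain.monotone hij, hlate, fun j => rfl⟩
  calc _ ≤ ∑ g ∈ Finset.univ.filter fun g : Fin k → Fin K => Monotone g,
        (slotLaw V (2 * K) p).real {Y | LateIsolated Y (f (Fin.last k)) ∧
          ∀ j, Y (chainEdge f j) = (cast (g j)).castSucc} :=
        (measureReal_mono hsub (measure_ne_top _ _)).trans (measureReal_biUnion_finset_le _ _)
    _ ≤ _ := (Finset.sum_le_card_nsmul _ _ _ fun g _ =>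
        slotLaw_real_lateIsolated_inter_chain_le hf fun j => cast (g j))
    _ ≤ _ := by
        rw [nsmul_eq_mul]
        gcongr
        exact card_monotone_le_multichoose K k

theorem card_filter_last_eq_le (k : ℕ) (v : V) :
    (Finset.univ.filter fun f : Fin (k + 1) → V => f (Fin.last k) = v).card ≤
      Fintype.card V ^ k := by
  rw [← Fintype.card_fin k, ← Fintype.card_fun, Fintype.card_fin, ← Finset.card_univ]
  refine Finset.card_le_card_of_injOn Fin.init (fun _ _ => Finset.mem_coe.2 (Finset.mem_univ _))
    fun f hf f' hf' h => ?_
  rw [Finset.mem_coe, Finset.mem_filter_univ] at hf hf'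
  rw [← Fin.snoc_init_self f, ← Fin.snoc_init_self f', h, hf, hf']

theorem slotLaw_real_mem_earlyReach_le (u v : V) :
    (slotLaw V (2 * K) p).real {Y | LateIsolated Y v ∧ u ∈ earlyReach Y v} ≤
      ∑ k ∈ Finset.range (Fintype.card V),
        ((Finset.univ.filter fun f : Fin (k + 1) → V => f (Fin.last k) = v).filter
          fun f => f 0 = u).card * (K.multichoose k *
            (((p : ℝ) / (2 * K)) ^ k * (1 - p / 2) ^ (Fintype.card V - 1))) := by
  let F (k : ℕ) : Finset (Fin (k + 1) → V) :=
    (Finset.univ.filter fun f => f (Fin.last k) = v).filter fun f => f 0 = u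
  have hcover : {Y : Sym2 V → Fin (2 * K + 1) | LateIsolated Y v ∧ u ∈ earlyReach Y v} ⊆
      ⋃ k ∈ Finset.range (Fintype.card V), ⋃ f ∈ F k,
        {Y | LateIsolated Y v ∧ IsEarlyChain Y f} := by
    rintro Y ⟨hlate, hu⟩
    obtain ⟨k, f, hf, hfu, hfv⟩ := mem_earlyReach.1 hu
    have hkn : k < Fintype.card V := by simpa using Fintype.card_le_of_injective f hf.injective
    exact Set.mem_iUnion₂.2 ⟨k, Finset.mem_range.2 hkn, Set.mem_iUnion₂.2
      ⟨f, by simp [F, hfu, hfv], hlate, hf⟩⟩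
  refine (measureReal_mono hcover (measure_ne_top _ _)).trans
    ((measureReal_biUnion_finset_le _ _).trans (Finset.sum_le_sum fun k _ => ?_))
  rw [← nsmul_eq_mul]
  exact (measureReal_biUnion_finset_le _ _).trans (Finset.sum_le_card_nsmul _ _ _ fun f hf =>
    slotLaw_real_lateIsolated_inter_isEarlyChain_le
      (Finset.mem_filter.1 (Finset.mem_filter.1 hf).1).2)

theorem sum_slotLaw_real_mem_earlyReach_le (v : V) (hK : (Fintype.card V : ℝ) * p < 2 * K) :
    ∑ u, (slotLaw V (2 * K) p).real {Y | LateIsolated Y v ∧ u ∈ earlyReach Y v} ≤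
      (1 - p / 2) ^ (Fintype.card V - 1) *
        ((1 - (Fintype.card V : ℝ) * p / (2 * K))⁻¹) ^ K := by
  set n := Fintype.card V
  set q : ℝ := (1 - p / 2) ^ (n - 1)
  have hq : 0 ≤ q := pow_nonneg (by linarith [p.2.2]) _
  have hp : 0 ≤ (p : ℝ) := p.2.1
  have hK0 : 0 < (K : ℝ) := Nat.cast_pos.2 (NeZero.pos K)
  let ending (k : ℕ) : Finset (Fin (k + 1) → V) := Finset.univ.filter fun f => f (Fin.last k) = v
  have hfiber (k : ℕ) :
      ∑ u, (((ending k).filter fun f => f 0 = u).card : ℝ) = (ending k).card := by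
    rw [← Nat.cast_sum, ← Finset.card_eq_sum_card_fiberwise fun f _ => Finset.mem_coe.2
      (Finset.mem_univ (f 0))]
  calc _ ≤ ∑ u, ∑ k ∈ Finset.range n, (((ending k).filter fun f => f 0 = u).card : ℝ) *
        (K.multichoose k * (((p : ℝ) / (2 * K)) ^ k * q)) :=
        Finset.sum_le_sum fun u _ => slotLaw_real_mem_earlyReach_le u v
    _ = ∑ k ∈ Finset.range n,
        ((ending k).card : ℝ) * (K.multichoose k * (((p : ℝ) / (2 * K)) ^ k * q)) := by
        rw [Finset.sum_comm]
        simp only [← Finset.sum_mul, hfiber]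
    _ ≤ ∑ k ∈ Finset.range n, (n : ℝ) ^ k * (K.multichoose k * (((p : ℝ) / (2 * K)) ^ k * q)) := by
        gcongr with k
        exact_mod_cast card_filter_last_eq_le k v
    _ = q * ∑ k ∈ Finset.range n, (K.multichoose k : ℝ) * (n * (p : ℝ) / (2 * K)) ^ k := by
        rw [Finset.mul_sum]
        refine Finset.sum_congr rfl fun k _ => ?_
        rw [mul_div_assoc, mul_pow]
        ring
    _ ≤ q * ((1 - n * (p : ℝ) / (2 * K))⁻¹) ^ K := by
        gcongr
        exact sum_multichoose_mul_pow_le (by positivity)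
          ((div_lt_one (by positivity)).2 hK) (NeZero.pos K) _

end InfiniteDoubling

section InfiniteDoublingBound

variable {V : Type*} [Fintype V] [DecidableEq V] {K : ℕ}

open scoped Classical in
theorem double_eq_top_of_card_lateIsolated {Y : Sym2 V → Fin (2 * K + 1)}
    {σ : EdgeOrder (slotGraph Y)} (hσ : Refines (fun e : (slotGraph Y).edgeSet => Y e) σ)
    {m : ℝ} (hm : 4 ≤ m) (hmany : m < 2 * (Finset.univ.filter fun v => LateIsolated Y v).card)
    (hfew : ((Finset.univ.filter fun x : V × V =>
      LateIsolated Y x.1 ∧ x.2 ∈ earlyReach Y x.1).card : ℝ) < Fintype.card V * m / 16) :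
    (ofEdgeOrder (slotGraph Y) σ).double = ⊤ := by
  let late : Finset V := Finset.univ.filter fun v => LateIsolated Y v
  let good := late.filter fun v => 4 * (earlyReach Y v).card ≤ Fintype.card V
  let bad := late.filter fun v => ¬ 4 * (earlyReach Y v).card ≤ Fintype.card V
  suffices hgood : 1 < good.card by
    obtain ⟨v, hv, w, hw, hne⟩ := Finset.one_lt_card.1 hgood
    obtain ⟨hvl, hvr⟩ := Finset.mem_filter.1 hv
    obtain ⟨hwl, hwr⟩ := Finset.mem_filter.1 hw
    exact double_eq_top_of_lateIsolated hσ hne (Finset.mem_filter.1 hvl).2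
      (Finset.mem_filter.1 hwl).2 hvr hwr
  by_contra! hgood
  have hsplit : (good.card : ℝ) + bad.card = late.card := by
    exact_mod_cast Finset.card_filter_add_card_filter_not (s := late) _
  have hgood' : (good.card : ℝ) ≤ 1 := by exact_mod_cast hgood
  have hsigma : (bad.sigma fun v => earlyReach Y v).card ≤ (Finset.univ.filter fun x : V × V =>
      LateIsolated Y x.1 ∧ x.2 ∈ earlyReach Y x.1).card := by
    refine Finset.card_le_card_of_injOn (fun x => (x.1, x.2)) (fun x hx => ?_) ?_
    · obtain ⟨hx₁, hx₂⟩ := Finset.mem_sigma.1 hx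
      exact Finset.mem_coe.2 <| Finset.mem_filter.2 ⟨Finset.mem_univ _,
        (Finset.mem_filter.1 (Finset.mem_filter.1 hx₁).1).2, hx₂⟩
    · exact fun x _ y _ hxy => Sigma.ext (congrArg Prod.fst hxy) (heq_of_eq (congrArg Prod.snd hxy))
  have hbad : (bad.card : ℝ) * (Fintype.card V / 4) ≤ (bad.sigma fun v => earlyReach Y v).card := by
    rw [Finset.card_sigma, Nat.cast_sum, ← nsmul_eq_mul]
    refine Finset.card_nsmul_le_sum _ _ _ fun v hv => ?_
    have : (Fintype.card V : ℝ) ≤ 4 * (earlyReach Y v).card := by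
      exact_mod_cast (not_le.1 (Finset.mem_filter.1 hv).2).le
    linarith
  have hlow : (m / 4) * (Fintype.card V / 4) ≤ (bad.card : ℝ) * (Fintype.card V / 4) := by
    gcongr
    linarith
  have := (hlow.trans hbad).trans (Nat.cast_le.2 hsigma)
  linarith

variable [NeZero K] {p : unitInterval}

theorem sum_slotLaw_real_lateIsolated (p : unitInterval) :
    ∑ v : V, (slotLaw V (2 * K) p).real {Y | LateIsolated Y v} =
      Fintype.card V * (1 - (p : ℝ) / 2) ^ Fintype.card V := by
  simp only [slotLaw_real_lateIsolated, Finset.sum_const, Finset.card_univ, nsmul_eq_mul]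

theorem sum_slotLaw_real_lateIsolated_inter_le (p : unitInterval) {m : ℝ}
    (hm : m = Fintype.card V * (1 - (p : ℝ) / 2) ^ Fintype.card V) :
    ∑ v : V, ∑ w : V, (slotLaw V (2 * K) p).real
      ({Y | LateIsolated Y v} ∩ {Y | LateIsolated Y w}) ≤ m + m ^ 2 / (1 - p / 2) := by
  have hQ : 0 < 1 - (p : ℝ) / 2 := by linarith [p.2.2]
  set n := Fintype.card V with hn
  set Q := 1 - (p : ℝ) / 2
  have hpair (v w : V) : (slotLaw V (2 * K) p).real
      ({Y | LateIsolated Y v} ∩ {Y | LateIsolated Y w}) ≤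
        (if v = w then Q ^ n else 0) + (Q ^ n) ^ 2 / Q := by
    split_ifs with h
    · subst h
      rw [Set.inter_self, slotLaw_real_lateIsolated]
      exact le_add_of_nonneg_right (by positivity)
    · have hn0 : 0 < 2 * n := mul_pos two_pos (Fintype.card_pos_iff.2 ⟨v⟩)
      rw [slotLaw_real_lateIsolated_inter p h, zero_add, ← pow_mul, mul_comm n,
        le_div_iff₀ hQ, pow_sub_one_mul hn0.ne']
  calc _ ≤ ∑ v : V, ∑ w : V, ((if v = w then Q ^ n else 0) + (Q ^ n) ^ 2 / Q) :=
        Finset.sum_le_sum fun v _ => Finset.sum_le_sum fun w _ => hpair v w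
    _ = m + m ^ 2 / Q := by
        simp only [Finset.sum_add_distrib, Finset.sum_ite_eq, Finset.mem_univ, if_true,
          Finset.sum_const, Finset.card_univ, nsmul_eq_mul, ← hn, hm]
        ring

open scoped Classical in
theorem slotLaw_real_two_mul_card_lateIsolated_le [Nonempty V] {m : ℝ}
    (hm : m = Fintype.card V * (1 - (p : ℝ) / 2) ^ Fintype.card V) :
    (slotLaw V (2 * K) p).real
        {Y | 2 * ((Finset.univ.filter fun v => LateIsolated Y v).card : ℝ) ≤ m} ≤
      4 * (1 / (1 - p / 2) - 1 + 1 / m) := by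
  have hQ : 0 < 1 - (p : ℝ) / 2 := by linarith [p.2.2]
  have hm0 : 0 < m := hm ▸ mul_pos (Nat.cast_pos.2 Fintype.card_pos) (pow_pos hQ _)
  refine (measureReal_two_mul_card_filter_mem_le
    (fun v => (Set.toFinite {Y | LateIsolated Y v}).measurableSet) hm0
    ((sum_slotLaw_real_lateIsolated p).trans hm.symm)).trans ?_
  rw [div_le_iff₀ (by positivity)]
  have hsecond := sum_slotLaw_real_lateIsolated_inter_le (K := K) p hm
  calc _ ≤ 4 * (m + m ^ 2 / (1 - (p : ℝ) / 2) - m ^ 2) := by gcongr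
    _ = _ := by field_simp; ring

open scoped Classical in
theorem slotLaw_real_le_card_earlyReach_le [Nonempty V] {m : ℝ}
    (hm : m = Fintype.card V * (1 - (p : ℝ) / 2) ^ Fintype.card V)
    (hK : (Fintype.card V : ℝ) * p < 2 * K) :
    (slotLaw V (2 * K) p).real {Y | Fintype.card V * m / 16 ≤
        ((Finset.univ.filter fun x : V × V =>
          LateIsolated Y x.1 ∧ x.2 ∈ earlyReach Y x.1).card : ℝ)} ≤
      16 * ((1 - (Fintype.card V : ℝ) * p / (2 * K))⁻¹) ^ K /
        (Fintype.card V * (1 - p / 2)) := by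
  have hQ : 0 < 1 - (p : ℝ) / 2 := by linarith [p.2.2]
  have hn : (0 : ℝ) < Fintype.card V := Nat.cast_pos.2 Fintype.card_pos
  have hm0 : 0 < m := hm ▸ mul_pos hn (pow_pos hQ _)
  have ht : 0 < Fintype.card V * m / 16 := by positivity
  let A (x : V × V) : Set (Sym2 V → Fin (2 * K + 1)) :=
    {Y | LateIsolated Y x.1 ∧ x.2 ∈ earlyReach Y x.1}
  calc _ ≤ (∑ x, (slotLaw V (2 * K) p).real (A x)) / (Fintype.card V * m / 16) := by
        convert measureReal_le_card_filter_mem_le (μ := slotLaw V (2 * K) p)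
          (fun x => (Set.toFinite (A x)).measurableSet) ht
        rfl
    _ ≤ (Fintype.card V * ((1 - (p : ℝ) / 2) ^ (Fintype.card V - 1) *
          ((1 - (Fintype.card V : ℝ) * p / (2 * K))⁻¹) ^ K)) / (Fintype.card V * m / 16) := by
        rw [Fintype.sum_prod_type]
        gcongr
        rw [← nsmul_eq_mul]
        exact Finset.sum_le_card_nsmul _ _ _ fun v _ => sum_slotLaw_real_mem_earlyReach_le v hK
    _ = _ := by
        rw [hm, ← pow_sub_one_mul Fintype.card_ne_zero (1 - (p : ℝ) / 2)]
        generalize 1 - (p : ℝ) / 2 = Q at hQ ⊢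
        field_simp

end InfiniteDoublingBound

theorem rstg_real_double_eq_top_ge {V : Type*} [Fintype V] [Nonempty V] {K : ℕ} [NeZero K]
    {p : unitInterval} {m : ℝ}
    (hm : m = Fintype.card V * (1 - (p : ℝ) / 2) ^ Fintype.card V) (hm4 : 4 ≤ m)
    (hK : (Fintype.card V : ℝ) * p < 2 * K) :
    1 - (4 * (1 / (1 - p / 2) - 1 + 1 / m) +
        16 * ((1 - (Fintype.card V : ℝ) * p / (2 * K))⁻¹) ^ K / (Fintype.card V * (1 - p / 2))) ≤
      (rstg V p).toMeasure.real {H | H.double = ⊤} := by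
  classical
  set few : Set (Sym2 V → Fin (2 * K + 1)) :=
    {Y | 2 * ((Finset.univ.filter fun v => LateIsolated Y v).card : ℝ) ≤ m}
  set many : Set (Sym2 V → Fin (2 * K + 1)) := {Y | Fintype.card V * m / 16 ≤
    ((Finset.univ.filter fun x : V × V => LateIsolated Y x.1 ∧ x.2 ∈ earlyReach Y x.1).card : ℝ)}
  have hbad := (measureReal_union_le (μ := slotLaw V (2 * K) p) few many).trans
    (add_le_add (slotLaw_real_two_mul_card_lateIsolated_le hm)
      (slotLaw_real_le_card_earlyReach_le hm hK))
  refine (sub_le_sub_left hbad 1).trans ?_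
  rw [← probReal_compl_eq_one_sub (Set.toFinite _).measurableSet]
  refine slotLaw_real_le_rstg_real p fun Y hY σ hσ => ?_
  rw [Set.compl_union] at hY
  exact double_eq_top_of_card_lateIsolated hσ hm4 (not_le.1 fun h => hY.1 h)
    (not_le.1 fun h => hY.2 h)

section InfiniteDoublingLimit

theorem inv_one_sub_pow_le_exp {x : ℝ} (hx : x ≤ 1 / 2) (K : ℕ) :
    ((1 - x)⁻¹) ^ K ≤ Real.exp (K * (x + 2 * x ^ 2)) := by
  rw [Real.exp_nat_mul]
  refine pow_le_pow_left₀ (inv_nonneg.2 (by linarith)) ?_ K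
  rw [inv_le_iff_one_le_mul₀' (by linarith)]
  calc 1 ≤ (1 - x) * (x + 2 * x ^ 2 + 1) := by nlinarith [sq_nonneg x]
    _ ≤ _ := mul_le_mul_of_nonneg_left (Real.add_one_le_exp _) (by linarith)

theorem inv_one_sub_div_pow_sq_le_exp {n : ℕ} (hn : 0 < n) {p : ℝ} (hp0 : 0 ≤ p) (hp1 : p ≤ 1) :
    ((1 - (n : ℝ) * p / (2 * (n ^ 2 : ℕ)))⁻¹) ^ n ^ 2 ≤ Real.exp (n * p / 2 + 1) := by
  have hn1 : (1 : ℝ) ≤ n := Nat.one_le_cast.2 hn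
  have hx : (n : ℝ) * p / (2 * (n ^ 2 : ℕ)) = p / (2 * n) := by
    push_cast
    field_simp
  have hx2 : p / (2 * n) ≤ 1 / 2 := by
    rw [div_le_iff₀ (by positivity)]
    linarith
  rw [hx]
  refine (inv_one_sub_pow_le_exp hx2 _).trans (Real.exp_le_exp.2 ?_)
  calc ((n ^ 2 : ℕ) : ℝ) * (p / (2 * n) + 2 * (p / (2 * n)) ^ 2) = n * p / 2 + p ^ 2 / 2 := by
        push_cast
        field_simp
    _ ≤ n * p / 2 + 1 := by nlinarith

theorem exp_half_mul_add_one_div_le {n p c : ℝ} (hn : 0 < n)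
    (hp : p ≤ (2 - c) * (Real.log n / n)) :
    Real.exp (n * p / 2 + 1) / n ≤ Real.exp 1 * Real.exp (-(c / 2 * Real.log n)) := by
  have hnp : n * p ≤ (2 - c) * Real.log n := by rwa [← mul_div_assoc, le_div_iff₀' hn] at hp
  rw [div_le_iff₀ hn, ← Real.exp_add]
  nth_rewrite 3 [← Real.exp_log hn]
  rw [← Real.exp_add]
  exact Real.exp_le_exp.2 (by linarith)

theorem rstg_real_double_eq_top_ge_of_le {V : Type*} [Fintype V] [Nonempty V] {p : unitInterval}
    {c y : ℝ} (hp : (p : ℝ) ≤ (2 - c) * (Real.log (Fintype.card V) / Fintype.card V))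
    (hpn : Fintype.card V * (p : ℝ) ^ 2 ≤ 2)
    (hy : y = Real.exp 1 * Real.exp (-(c / 2 * Real.log (Fintype.card V)))) (hy4 : y ≤ 1 / 4) :
    1 - (4 * p + 36 * y) ≤ (rstg V p).toMeasure.real {H | H.double = ⊤} := by
  classical
  have hp0 : 0 ≤ (p : ℝ) := p.2.1
  have hp1 : (p : ℝ) ≤ 1 := p.2.2
  have hn1 : (1 : ℝ) ≤ Fintype.card V := Nat.one_le_cast.2 Fintype.card_pos
  have : NeZero (Fintype.card V ^ 2) := ⟨pow_ne_zero 2 Fintype.card_ne_zero⟩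
  set n := Fintype.card V
  set Q := 1 - (p : ℝ) / 2 with hQ
  have hQ2 : 1 / 2 ≤ Q := by linarith
  have hK : (n : ℝ) * p < 2 * (n ^ 2 : ℕ) := by
    push_cast
    nlinarith
  set B := ((1 - (n : ℝ) * p / (2 * (n ^ 2 : ℕ)))⁻¹) ^ n ^ 2
  have hexp : Real.exp (n * p / 2 + 1) / n ≤ y :=
    hy ▸ exp_half_mul_add_one_div_le (by positivity) hp
  have hm : 1 / (n * Q ^ n) ≤ y := by
    refine le_trans ?_ hexp
    rw [mul_comm (n : ℝ), ← div_div, one_div, ← inv_pow]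
    gcongr
    exact (inv_one_sub_pow_le_exp (by linarith) n).trans
      (Real.exp_le_exp.2 (by linarith))
  have hBy : B / n ≤ y :=
    (div_le_div_of_nonneg_right (inv_one_sub_div_pow_sq_le_exp Fintype.card_pos hp0 hp1)
      (Nat.cast_nonneg n)).trans hexp
  have hQp : 1 / Q - 1 ≤ p := by
    rw [sub_le_iff_le_add, div_le_iff₀ (by linarith)]
    nlinarith
  have hm4 : 4 ≤ n * Q ^ n := (one_div_le_one_div (by positivity) (by norm_num)).1 (hm.trans hy4)
  have hBQ : 16 * B / (n * Q) ≤ 32 * y := by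
    rw [← div_div, div_le_iff₀ (by linarith), mul_div_assoc]
    nlinarith [hm.trans' (by positivity : 0 ≤ 1 / (n * Q ^ n))]
  exact le_trans (by linarith) (rstg_real_double_eq_top_ge rfl hm4 hK)

theorem tendsto_rstg_double_eq_top (β : ℕ → unitInterval) {c : ℝ} (hc : 0 < c)
    (hβ : ∀ᶠ n : ℕ in atTop, (β n : ℝ) < (2 - c) * (Real.log n / n)) :
    Tendsto (fun n : ℕ => (rstg (Fin n) (β n)).toMeasure {H | H.double = ⊤}) atTop (𝓝 1) := by
  set y : ℕ → ℝ := fun n => Real.exp 1 * Real.exp (-(c / 2 * Real.log n))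
  have hy0 : Tendsto y atTop (𝓝 0) := by
    rw [← mul_zero (Real.exp 1)]
    exact (tendsto_exp_neg_mul_log_natCast (half_pos hc)).const_mul _
  have hlog (k : ℕ) : Tendsto (fun n : ℕ => Real.log n ^ k / n) atTop (𝓝 0) := by
    simpa [Function.comp_def] using
      (Real.tendsto_pow_log_div_mul_add_atTop 1 0 k one_ne_zero).comp tendsto_natCast_atTop_atTop
  have hβ2 : ∀ᶠ n : ℕ in atTop, (β n : ℝ) ≤ 2 * (Real.log n / n) := by
    filter_upwards [hβ] with n hn
    have : 0 ≤ Real.log n / n := div_nonneg (Real.log_natCast_nonneg n) (Nat.cast_nonneg n)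
    nlinarith
  have hβ0 : Tendsto (fun n => (β n : ℝ)) atTop (𝓝 0) :=
    squeeze_zero' (.of_forall fun n => (β n).2.1) hβ2 (by simpa using (hlog 1).const_mul 2)
  have hlow : Tendsto (fun n => ENNReal.ofReal (1 - (4 * β n + 36 * y n))) atTop (𝓝 1) := by
    simpa using ENNReal.tendsto_ofReal (((hβ0.const_mul 4).add (hy0.const_mul 36)).const_sub 1)
  refine tendsto_of_tendsto_of_tendsto_of_le_of_le' hlow tendsto_const_nhds ?_
    (.of_forall fun n => prob_le_one)
  filter_upwards [hβ, hβ2, hy0.eventually_le_const (show (0 : ℝ) < 1 / 4 by norm_num),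
    (hlog 2).eventually_le_const (show (0 : ℝ) < 1 / 2 by norm_num), eventually_gt_atTop 0]
    with n hβn hβn2 hyn hlogn hn
  have : NeZero n := ⟨hn.ne'⟩
  have hsq : (n : ℝ) * (β n : ℝ) ^ 2 ≤ 2 :=
    calc (n : ℝ) * (β n : ℝ) ^ 2 ≤ n * (2 * (Real.log n / n)) ^ 2 := by
          gcongr
          exact (β n).2.1
      _ = 4 * (Real.log n ^ 2 / n) := by
          field_simp
          ring
      _ ≤ 2 := by linarith
  exact ENNReal.ofReal_le_of_le_toReal (rstg_real_double_eq_top_ge_of_le (c := c)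
    (by simpa using hβn.le) (by simpa using hsq) (by rw [Fintype.card_fin]) hyn)

end InfiniteDoublingLimit

end TemporalGraph

theorem mainTheorem6 (β : ℕ → unitInterval) :
    ((∃ c : ℝ, 0 < c ∧ ∀ᶠ n : ℕ in atTop, (2 + c) * (Real.log n / n) < (β n : ℝ)) →
      Tendsto (fun n : ℕ =>
          (TemporalGraph.rstg (Fin n) (β n)).toMeasure {H | H.double < ⊤})
        atTop (𝓝 1)) ∧
    ((∃ c : ℝ, 0 < c ∧ ∀ᶠ n : ℕ in atTop, (β n : ℝ) < (2 - c) * (Real.log n / n)) →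
      Tendsto (fun n : ℕ =>
          (TemporalGraph.rstg (Fin n) (β n)).toMeasure {H | H.double = ⊤})
        atTop (𝓝 1)) :=
  ⟨fun ⟨_, hc, h⟩ => TemporalGraph.tendsto_rstg_double_lt_top β hc h,
    fun ⟨_, hc, h⟩ => TemporalGraph.tendsto_rstg_double_eq_top β hc h⟩
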